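/- **Setting.** An environment consists of finite sets $\mathcal S,\mathcal A,\mathcal O$ of states, actions and observations, a stochastic transition function $\Delta(s'\mid s,a)$ and an observation function $\Omega:\mathcal S\to\mathcal O$. A planning problem $\mathcal P$ is an environment with an initial state $s_0$ and a set $\mathcal G$ of goal states. A finite state controller (FSC) $C$ has a finite set $Q$ of controller states, an initial state $q_0\in Q$, and partial functions $\gamma:Q\times\mathcal O\to\mathcal A\cup\{\mathtt{stop}\}$ and $\delta:Q\times\mathcal O\to Q$; it is $N$-bounded if $|Q|\le N$. A history is a finite sequence of combined states $\langle q^{(t)},s^{(t)}\rangle_{t=0}^T$ starting at $\langle q_0,s_0\rangle$, such that for each $t<T$ the label $a^{(t)}=\gamma(q^{(t)},\Omega(s^{(t)}))$ is an action, $q^{(t+1)}=\delta(q^{(t)},\Omega(s^{(t)}))$, and $\Delta(s^{(t+1)}\mid s^{(t)},a^{(t)})>0$. Its likelihood $\ell$ is the product of these probabilities. It is terminating if $\gamma(q^{(T)},\Omega(s^{(T)}))=\mathtt{stop}$, and a goal history if moreover $s^{(T)}\in\mathcal G$. $\mathbf{LTER}$ and $\mathbf{LGT}$ denote the sums of the likelihoods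 of all terminating histories and of all goal histories, respectively. **The algorithm PANDOR.** Given $\mathcal P$, an integer $N\ge 1$ and thresholds $LTER^\star,LGT^\star\in(0,1)$, PANDOR is the following depth-first AND-OR search with backtracking over partial controllers with states $0,\dots,N-1$ and initial state $0$; arithmetic is exact. Let $h=\langle h^{(0)},\dots,h^{(L-1)}\rangle$ be the current history, let $p^{(k)}$ be the probability of the step from $h^{(k-1)}$ to $h^{(k)}$, with $p^{(0)}=1$. The search keeps numbers $\alpha_{\mathrm{goal}}^{(k)},\alpha_{\mathrm{fail}}^{(k)},\alpha_{\mathrm{noter}}^{(k)}$ $(0\le k\le L)$ and $\alpha_{\mathrm{loop}}^{(k,m)}$ $(0\le k\le m<L)$. It starts with the AND-step on the empty controller, $q=0$, the single outcome $s_0$ of probability $1$, the empty history and all $\alpha$ equal to $0$. * AND-step (controller $C$, controller state $q$, outcomes $s'$ with probabilities $p$, history $h$): for each outcome, in any order, run the OR-step on $\langle q,s'\rangle$, and then compute $\lambda_\bullet=\lambda_\bullet^{(0)}$ by CalcLambda. If $\lambda_{\mathrm{goal}}\ge LGT^\star$ and $\lambda_{\mathrm{goal}}+\lambda_{\mathrm{fail}}\ge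 LTER^\star$, return the current controller at once; else if $1-\lambda_{\mathrm{fail}}-\lambda_{\mathrm{noter}}<LGT^\star$ or $1-\lambda_{\mathrm{noter}}<LTER^\star$, fail this non-deterministic branch, i.e. backtrack to the last choice point with an untried alternative. When all outcomes have been treated, return the current controller. On each return from a nonempty $h$, CumulateAlpha is applied to the $\alpha$ values and the last element of $h$ is removed. * OR-step (on $\langle q,s\rangle$, reached with probability $p$): if $\langle q,s\rangle=h^{(k)}$ for some $k$, let $p_{\mathrm{loop}}=\ell(h^{(k)},\dots,h^{(L-1)})\,p$; if $p_{\mathrm{loop}}<1$ add $p_{\mathrm{loop}}$ to $\alpha_{\mathrm{loop}}^{(k,L-1)}$, otherwise add $p$ to $\alpha_{\mathrm{noter}}^{(L)}$; return. If $\langle q,s\rangle\notin h$ and $C$ has no transition for $(q,\Omega(s))$, choose non-deterministically (trying all alternatives in any order) a label in $\mathcal A\cup\{\mathtt{stop}\}$ and a next controller state $q'\in\{0,\dots,N-1\}$ and add this transition to $C$. If the label of the transition is $\mathtt{stop}$, add $p$ to $\alpha_{\mathrm{goal}}^{(L)}$ or $\alpha_{\mathrm{fail}}^{(L)}$ according to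 whether $s\in\mathcal G$, and return; if it is an action $a$, append $\langle q,s\rangle$ to $h$, extend $\alpha$ by zeros, and run the AND-step on $q'$ and the outcomes $\{s':\Delta(s'\mid s,a)>0\}$ with their probabilities. * CalcLambda: $\lambda_\bullet^{(L)}=\alpha_\bullet^{(L)}$ for $\bullet\in\{\mathrm{goal},\mathrm{fail},\mathrm{noter}\}$; for $k=L-1,\dots,0$ put $\lambda_{\mathrm{loop}}^{(k)}=\sum_{m=k}^{L-1}\alpha_{\mathrm{loop}}^{(k,m)}\prod_{j=k+1}^m(1-\lambda_{\mathrm{loop}}^{(j)})^{-1}$ and $\lambda_\bullet^{(k)}=p^{(k)}\lambda_\bullet^{(k+1)}/(1-\lambda_{\mathrm{loop}}^{(k)})+\alpha_\bullet^{(k)}$, except that if $\lambda_{\mathrm{loop}}^{(k)}+\lambda_{\mathrm{noter}}^{(k+1)}=1$ then $\lambda_{\mathrm{loop}}^{(k)}$ is reset to $0$ in these formulas and $\lambda_{\mathrm{noter}}^{(k)}=p^{(k)}+\alpha_{\mathrm{noter}}^{(k)}$. * CumulateAlpha, with $n=L-1$: perform the step $k=n$ of CalcLambda, replace $\alpha_\bullet^{(n)}$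 by $\lambda_\bullet^{(n)}$, add $\alpha_{\mathrm{loop}}^{(k,n)}/(1-\lambda_{\mathrm{loop}}^{(n)})$ to $\alpha_{\mathrm{loop}}^{(k,n-1)}$ for each $k<n$, and delete $\alpha_\bullet^{(n+1)}$ and the $n$-th row and column of $\alpha_{\mathrm{loop}}$. **Theorem.** For every planning problem $\mathcal P$, every integer $N\ge1$, all $LTER^\star,LGT^\star\in(0,1)$, and all orders of enumeration, PANDOR is sound and complete: 1. every FSC returned by PANDOR (on any non-failing non-deterministic branch) is $N$-bounded and satisfies $\mathbf{LTER}\ge LTER^\star$ and $\mathbf{LGT}\ge LGT^\star$ for $\mathcal P$; 2. if there exists an $N$-bounded FSC with $\mathbf{LTER}\ge LTER^\star$ and $\mathbf{LGT}\ge LGT^\star$ for $\mathcal P$, then the search finds and returns one such FSC. -/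

import Mathlib

open scoped ENNReal

noncomputable section

/-! ## Environments, planning problems, controllers -/

/-- An environment with states `S`, actions `A`, observations `O`. -/
structure Environment (S A O : Type*) where
  /-- stochastic state transition function -/
  Δ : S → A → PMF S
  /-- observation function -/
  Ω : S → O

/-- A planning problem: an environment, an initial state and a set of goal states. -/
structure PlanningProblem (S A O : Type*) extends Environment S A O where
  s₀ : S
  G : Set S

/-- Labels of controller transitions: an action, or the special action `halt` (stop). -/
inductive Label (A : Type*) where
  | act (a : A) : Label A
  | halt : Label A

/-- A finite state controller with controller states `Q` (finiteness of `Q` is required where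
controllers are quantified over). The labeling function `γ` and the transition function `δ`
are partial. -/
structure FSC (Q O A : Type*) where
  q₀ : Q
  γ : Q → O → Option (Label A)
  δ : Q → O → Option Q

namespace FSC

variable {Q S A O : Type*}

/-- A controller is `N`-bounded if it has at most `N` controller states. -/
def Bounded [Fintype Q] (_C : FSC Q O A) (N : ℕ) : Prop := Fintype.card Q ≤ N

open Classical in
/-- The probability that the system moves from the combined state `x` to the combined state `y`
in one step. It is `0` if the controller stops or is undefined at `x`. -/
def stepProb (C : FSC Q O A) (E : Environment S A O) (x y : Q × S) : ℝ≥0∞ :=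
  match C.γ x.1 (E.Ω x.2), C.δ x.1 (E.Ω x.2) with
  | some (.act a), some q' => if y.1 = q' then E.Δ x.2 a y.2 else 0
  | _, _ => 0

/-- The likelihood of a sequence of combined states. -/
def likelihood (C : FSC Q O A) (E : Environment S A O) : List (Q × S) → ℝ≥0∞
  | [] => 1
  | [_] => 1
  | x :: y :: t => C.stepProb E x y * likelihood C E (y :: t)

/-- `h` is a history of the system for the problem `P`, started in `⟨q₀, s₀⟩`. -/
def IsHistory (C : FSC Q O A) (P : PlanningProblem S A O) (h : List (Q × S)) : Prop :=
  h.head? = some (C.q₀, P.s₀) ∧ h.IsChain (fun x y => 0 < C.stepProb P.toEnvironment x y)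

/-- A history is terminating if the controller executes the stop action in its last combined state. -/
def IsTerminating (C : FSC Q O A) (P : PlanningProblem S A O) (h : List (Q × S)) : Prop :=
  C.IsHistory P h ∧ ∃ x, h.getLast? = some x ∧ C.γ x.1 (P.Ω x.2) = some .halt

/-- A goal history is a terminating history whose last environment state is a goal state. -/
def IsGoal (C : FSC Q O A) (P : PlanningProblem S A O) (h : List (Q × S)) : Prop :=
  C.IsTerminating P h ∧ ∃ x, h.getLast? = some x ∧ x.2 ∈ P.G

/-- Total likelihood of termination. -/
def LTER (C : FSC Q O A) (P : PlanningProblem S A O) : ℝ≥0∞ :=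
  ∑' h : {h : List (Q × S) // C.IsTerminating P h}, C.likelihood P.toEnvironment h.1

/-- Total likelihood of goal termination. -/
def LGT (C : FSC Q O A) (P : PlanningProblem S A O) : ℝ≥0∞ :=
  ∑' h : {h : List (Q × S) // C.IsGoal P h}, C.likelihood P.toEnvironment h.1

/-- The empty controller, with initial state `q₀` and no transition. -/
def empty (q₀ : Q) : FSC Q O A := ⟨q₀, fun _ _ => none, fun _ _ => none⟩

open Classical in
/-- The controller `C ∪ {q --o/l--> q'}`. -/
def extend (C : FSC Q O A) (q : Q) (o : O) (l : Label A) (q' : Q) : FSC Q O A where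
  q₀ := C.q₀
  γ := Function.update C.γ q (Function.update (C.γ q) o (some l))
  δ := Function.update C.δ q (Function.update (C.δ q) o (some q'))

end FSC

namespace Pandor

variable {Q S A O : Type*}

/-! ## Bookkeeping of likelihoods -/

/-- The `α` values kept by the search. While the current history is `h⁽⁰⁾, …, h⁽ᴸ⁻¹⁾`, the
meaningful entries are `goal k`, `fail k`, `noter k` for `k ≤ L` (likelihoods found after
`h⁽ᵏ⁻¹⁾` off the current history) and `loop k m` for `k ≤ m < L` (likelihood found for going
from `h⁽ᵏ⁾` along the current history to `h⁽ᵐ⁾`, leaving it there, and looping back to `h⁽ᵏ⁾`);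
all other entries are zero. -/
structure Alpha where
  goal : ℕ → ℝ
  fail : ℕ → ℝ
  noter : ℕ → ℝ
  loop : ℕ → ℕ → ℝ

namespace Alpha

/-- All values zero. -/
def zero : Alpha := ⟨fun _ => 0, fun _ => 0, fun _ => 0, fun _ _ => 0⟩

/-- Increase the `k`-th goal value by `x`. -/
def addGoal (α : Alpha) (k : ℕ) (x : ℝ) : Alpha :=
  { α with goal := Function.update α.goal k (α.goal k + x) }

/-- Increase the `k`-th fail value by `x`. -/
def addFail (α : Alpha) (k : ℕ) (x : ℝ) : Alpha :=
  { α with fail := Function.update α.fail k (α.fail k + x) }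

/-- Increase the `k`-th value for non-termination by `x`. -/
def addNoter (α : Alpha) (k : ℕ) (x : ℝ) : Alpha :=
  { α with noter := Function.update α.noter k (α.noter k + x) }

/-- Increase the loop value with index `(k, m)` by `x`. -/
def addLoop (α : Alpha) (k m : ℕ) (x : ℝ) : Alpha :=
  { α with loop := Function.update α.loop k (Function.update (α.loop k) m (α.loop k m + x)) }

/-- The current history grows from length `L` to `L + 1`: a zero item is appended to the vectors,
a zero row and column to the loop matrix. -/
def grow (α : Alpha) (L : ℕ) : Alpha where
  goal := Function.update α.goal (L + 1) 0
  fail := Function.update α.fail (L + 1) 0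
  noter := Function.update α.noter (L + 1) 0
  loop := fun k m => if k = L ∨ m = L then 0 else α.loop k m

end Alpha

/-- `p⁽ᵏ⁾`: the probability of the transition from `h⁽ᵏ⁻¹⁾` to `h⁽ᵏ⁾`, with `p⁽⁰⁾ = 1`. -/
def transProb (E : Environment S A O) (C : FSC Q O A) (h : List (Q × S)) : ℕ → ℝ
  | 0 => 1
  | k + 1 =>
    match h[k]?, h[k + 1]? with
    | some x, some y => (C.stepProb E x y).toReal
    | _, _ => 0

/-- The values `λ_goal⁽ᵏ⁾`, `λ_fail⁽ᵏ⁾`, `λ_noter⁽ᵏ⁾` for one `k`, and `λ_loop⁽ʲ⁾` for all `j ≥ k`. -/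
structure Lam where
  goal : ℝ
  fail : ℝ
  noter : ℝ
  loop : ℕ → ℝ

open Classical in
/-- One step of the backward calculation: from the `λ` values at `k + 1` to those at `k`, for a
current history of length `L` with transition probabilities `p`. -/
def lamStep (p : ℕ → ℝ) (α : Alpha) (L k : ℕ) (v : Lam) : Lam :=
  let l : ℝ := ∑ m ∈ Finset.Ico k L, α.loop k m * ∏ j ∈ Finset.Ioc k m, (1 - v.loop j)⁻¹
  if l + v.noter = 1 then
    -- no history through `h⁽ᵏ⁾` terminates: the loops at `k` are discarded
    { goal := p k * v.goal + α.goal k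
      fail := p k * v.fail + α.fail k
      noter := p k + α.noter k
      loop := Function.update v.loop k 0 }
  else
    { goal := p k * v.goal / (1 - l) + α.goal k
      fail := p k * v.fail / (1 - l) + α.fail k
      noter := p k * v.noter / (1 - l) + α.noter k
      loop := Function.update v.loop k l }

/-- The `λ` values at index `L - i`, for a current history of length `L`. -/
def lamBackward (p : ℕ → ℝ) (α : Alpha) (L : ℕ) : ℕ → Lam
  | 0 => { goal := α.goal L, fail := α.fail L, noter := α.noter L, loop := fun _ => 0 }
  | i + 1 => lamStep p α L (L - (i + 1)) (lamBackward p α L i)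

/-- CalcLambda: the `λ` values at index `0`. -/
def calcLambda (E : Environment S A O) (C : FSC Q O A) (h : List (Q × S)) (α : Alpha) : Lam :=
  lamBackward (transProb E C h) α h.length h.length

open Classical in
/-- CumulateAlpha for a history `h⁽⁰⁾, …, h⁽ⁿ⁾` with transition probabilities `p`: the last items
(last row and column) are integrated into the previous ones and deleted. -/
def cumulateLast (p : ℕ → ℝ) (α : Alpha) (n : ℕ) : Alpha :=
  let dead : Prop := α.loop n n + α.noter (n + 1) = 1
  let l : ℝ := if dead then 0 else α.loop n n
  { goal := fun k => if k < n then α.goal k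
      else if k = n then α.goal n + p n * α.goal (n + 1) / (1 - l) else 0
    fail := fun k => if k < n then α.fail k
      else if k = n then α.fail n + p n * α.fail (n + 1) / (1 - l) else 0
    noter := fun k => if k < n then α.noter k
      else if k = n then
        α.noter n + (if dead then p n else p n * α.noter (n + 1) / (1 - l)) else 0
    loop := fun k m => if k ≤ m ∧ m < n then
        α.loop k m + (if m + 1 = n then α.loop k n / (1 - l) else 0) else 0 }

/-- CumulateAlpha: applied when the last element of the current history `h` is about to be
removed (nothing happens at the root, where `h` is empty). -/
def cumulateAlpha (E : Environment S A O) (C : FSC Q O A) (h : List (Q × S)) (α : Alpha) : Alpha :=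
  match h.length with
  | 0 => α
  | n + 1 => cumulateLast (transProb E C h) α n

/-! ## The search -/

/-- The orders in which the search enumerates alternatives; they may depend on the current
controller, history and combined state. -/
structure SearchOrder (E : Environment S A O) (Q : Type*) where
  /-- the alternatives `⟨l, q'⟩` of a non-deterministic branch -/
  choices : FSC Q O A → List (Q × S) → Q × S → List (Label A × Q)
  mem_choices : ∀ C h x c, c ∈ choices C h x
  /-- the possible next states after an action -/
  outcomes : FSC Q O A → List (Q × S) → Q × S → A → List S
  nodup_outcomes : ∀ C h x a, (outcomes C h x a).Nodup
  mem_outcomes : ∀ C h x a s', s' ∈ outcomes C h x a ↔ 0 < E.Δ x.2 a s'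

/-- The number of combined states that do not occur in `h`. -/
def unvisited [Fintype Q] [Fintype S] (h : List (Q × S)) : ℕ :=
  {x : Q × S | x ∉ h}.ncard

theorem unvisited_append_lt [Fintype Q] [Fintype S] {h : List (Q × S)} {x : Q × S} (hx : x ∉ h) :
    unvisited (h ++ [x]) < unvisited h := by
  refine Set.ncard_lt_ncard ?_ (Set.toFinite _)
  refine ⟨fun y hy => fun hyh => hy (by simp [hyh]), fun hsub => ?_⟩
  exact hsub (show x ∈ {y | y ∉ h} from hx) (by simp)

section Search

variable (P : PlanningProblem S A O)
  (σ : SearchOrder P.toEnvironment Q) (LTERstar LGTstar : ℝ)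

/- A non-deterministic procedure is a function to lists. The list holds, in the order in which a
backtracking search produces them, the results of the non-deterministic branches that do not fail;
`[]` is failure, and `List.flatMap` runs the rest of the computation for each result in turn. -/
open Classical in
mutual

/-- AND-step. `outs` lists the outcomes that remain to be tested, with their probabilities; the
controller is in state `q` in all of them; `h` is the current history. -/
def andStep [Fintype Q] [Fintype S] (C : FSC Q O A) (q : Q) (outs : List (S × ℝ)) (h : List (Q × S)) (α : Alpha) :
    List (FSC Q O A × Alpha) :=
  match outs with
  | [] => [(C, cumulateAlpha P.toEnvironment C h α)]
  | (s, p) :: rest =>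
    (orStep C q s p h α).flatMap fun r =>
      let v := calcLambda P.toEnvironment r.1 h r.2
      if LGTstar ≤ v.goal ∧ LTERstar ≤ v.goal + v.fail then
        [(r.1, cumulateAlpha P.toEnvironment r.1 h r.2)]
      else if 1 - v.fail - v.noter < LGTstar ∨ 1 - v.noter < LTERstar then
        []
      else
        andStep r.1 q rest h r.2
termination_by (unvisited h, outs.length + 1)
decreasing_by
  all_goals (apply Prod.Lex.right; simp)

/-- OR-step in the combined state `⟨q, s⟩`, which was reached with probability `p` from the last
element of the current history `h`. -/
def orStep [Fintype Q] [Fintype S] (C : FSC Q O A) (q : Q) (s : S) (p : ℝ) (h : List (Q × S)) (α : Alpha) :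
    List (FSC Q O A × Alpha) :=
  if hmem : (q, s) ∈ h then
    let k := h.idxOf (q, s)
    let pLoop : ℝ := (C.likelihood P.toEnvironment (h.drop k)).toReal * p
    if pLoop < 1 then [(C, α.addLoop k (h.length - 1) pLoop)]
    else [(C, α.addNoter h.length p)]
  else
    let options : List (FSC Q O A × Label A × Q) :=
      match C.γ q (P.Ω s), C.δ q (P.Ω s) with
      | some l, some q' => [(C, l, q')]
      | _, _ => (σ.choices C h (q, s)).map fun c => (C.extend q (P.Ω s) c.1 c.2, c.1, c.2)
    options.flatMap fun o =>
      match o.2.1 with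
      | .halt => [(o.1, if s ∈ P.G then α.addGoal h.length p else α.addFail h.length p)]
      | .act a =>
        andStep o.1 o.2.2
          ((σ.outcomes o.1 h (q, s) a).map fun s' => (s', (P.Δ s a s').toReal))
          (h ++ [(q, s)]) (α.grow h.length)
termination_by (unvisited h, 0)
decreasing_by
  exact Prod.Lex.left _ _ (unvisited_append_lt hmem)

end

end Search

/-- The controllers returned by the non-failing non-deterministic branches of Pandor-synth with at
most `N` controller states, in the order of the backtracking search. The search starts with the
empty controller in its initial state, the empty history, and `s₀` as the only outcome. -/
def branches [Fintype S] (P : PlanningProblem S A O) (N : ℕ) [NeZero N]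
    (σ : SearchOrder P.toEnvironment (Fin N)) (LTERstar LGTstar : ℝ) : List (FSC (Fin N) O A) :=
  (andStep P σ LTERstar LGTstar (FSC.empty 0) 0 [(P.s₀, 1)] [] Alpha.zero).map Prod.fst

/-- Pandor-synth: the controller found first, or `none` if every branch fails. -/
def synth [Fintype S] (P : PlanningProblem S A O) (N : ℕ) [NeZero N]
    (σ : SearchOrder P.toEnvironment (Fin N)) (LTERstar LGTstar : ℝ) :
    Option (FSC (Fin N) O A) :=
  (branches P N σ LTERstar LGTstar).head?

end Pandor

end

-- The proof is a potential argument. Value combined states by a nonnegative `V` whose mean over the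
-- successors of an acting state is at most `cap (V x)` and which dominates the outcome weights at
-- halting states (`Admissible`). At each level of the current history, the likelihoods recorded in
-- `α`, the pending outcomes and the next history element together have a value bounded by the
-- potential (`Invariant`). Settling an outcome replaces its share `p * V x` by something no larger,
-- and CumulateAlpha replaces the value of the removed element by the solution of a linear
-- inequality (`Alpha.flow_le`). As CumulateAlpha is the first backward step of CalcLambda
-- (`lamBackward_cumulateLast`), folding the whole history gives `Invariant.calcLambda_le`: the
-- weighted sum of the `λ` values is at most `V x₀`.
--
-- Non-termination is the delicate outcome. On a closed loop every constant is harmonic, so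
-- superharmonicity alone cannot force `V` up to the weight of non-termination. The slack in `cap`
-- demands a strict decrease wherever `V` is below that weight, which a closed loop cannot afford
-- (`Weights.noter_le_of_le_cap`, `Invariant.noter_le_of_cycle`).
--
-- Suitable potentials give both directions. Halting probabilities, with weight zero for
-- non-termination, show that the computed goal and termination values are lower bounds of `LGT` and
-- `LTER`, so a success is genuine (`Success.le`). For a good controller `D` extending the current
-- one, the complement of its halting probability should bound the failure and non-termination
-- values; being harmonic it lacks slack, so the probability is truncated and discounted, and a
-- limit is taken. Hence no controller below `D` is pruned (`viable_of_le`).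
--
-- For unit weights and potential one the bound is an equality until a success occurs
-- (`Exhaustive`). At the root, once the only outcome is settled, goal, fail and noter therefore add
-- up to one, so passing the pruning test is the same as success. Every surviving branch thus
-- returns a successful controller. Completeness follows the choices of a total `D` on `Fin N` that
-- simulates the given controller.

noncomputable section

namespace Pandor

-- Weights and the strict superharmonicity bound.

/-- Nonnegative weights of the three kinds of outcomes of a run, and a positive slack. -/
structure Weights where
  goal : ℝ
  fail : ℝ
  noter : ℝ
  slack : ℝ
  goal_nonneg : 0 ≤ goal
  fail_nonneg : 0 ≤ fail
  noter_nonneg : 0 ≤ noter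
  slack_pos : 0 < slack

namespace Weights

/-- All weights equal to one. -/
def one : Weights := ⟨1, 1, 1, 1, zero_le_one, zero_le_one, zero_le_one, one_pos⟩

/-- The upper bound imposed on the mean of a potential over the successors of a state where the
potential has value `t`. It is at most `t`, and strictly less if `t` is less than the weight of
non-termination. -/
def cap (w : Weights) (t : ℝ) : ℝ := min t ((1 + w.slack) * t - w.slack * w.noter)

theorem cap_le (w : Weights) (t : ℝ) : w.cap t ≤ t := min_le_left _ _

theorem cap_le' (w : Weights) (t : ℝ) : w.cap t ≤ (1 + w.slack) * t - w.slack * w.noter :=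
  min_le_right _ _

theorem cap_one : one.cap 1 = 1 := by norm_num [cap, one]

/-- With `d = w.noter - t`, the hypothesis implies `t + (1 - l) * d ≤ t - w.slack * d`, so `(1 - l +
w.slack) * d ≤ 0`. The slack keeps the factor positive even for `l = 1`, a loop that is never left.
-/
theorem noter_le_of_le_cap (w : Weights) {l t : ℝ} (hl : l ≤ 1)
    (h : w.noter * (1 - l) + l * t ≤ w.cap t) : w.noter ≤ t := by
  have h1 := h.trans (w.cap_le' t)
  have h2 : 0 < 1 + w.slack - l := by linarith [w.slack_pos]
  have h3 : 0 ≤ (1 + w.slack - l) * (t - w.noter) := by nlinarith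
  linarith [nonneg_of_mul_nonneg_right h3 h2]

end Weights

-- Values recorded along the current history, and their cumulation.

/-- The likelihood of the part of the current history from index `k` to index `m`. -/
def pathProb (p : ℕ → ℝ) (k m : ℕ) : ℝ := ∏ i ∈ Finset.Ioc k m, p i

theorem pathProb_self (p : ℕ → ℝ) (k : ℕ) : pathProb p k k = 1 := by simp [pathProb]

theorem pathProb_succ (p : ℕ → ℝ) {k m : ℕ} (h : k ≤ m) :
    pathProb p k (m + 1) = pathProb p k m * p (m + 1) := by
  unfold pathProb
  rw [← Finset.insert_Ioc_right_eq_Ioc_add_one h, Finset.prod_insert (by simp), mul_comm]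

theorem pathProb_pos {p : ℕ → ℝ} {k m : ℕ} (h : ∀ i ≤ m, 0 < p i) : 0 < pathProb p k m :=
  Finset.prod_pos fun i hi => h i (Finset.mem_Ioc.mp hi).2

theorem pathProb_congr {p p' : ℕ → ℝ} {k m : ℕ} (h : ∀ i ≤ m, p i = p' i) :
    pathProb p k m = pathProb p' k m :=
  Finset.prod_congr rfl fun i hi => h i (Finset.mem_Ioc.mp hi).2

namespace Alpha

/-- All values are nonnegative. -/
structure Nonneg (α : Alpha) : Prop where
  goal : ∀ k, 0 ≤ α.goal k
  fail : ∀ k, 0 ≤ α.fail k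
  noter : ∀ k, 0 ≤ α.noter k
  loop : ∀ k m, 0 ≤ α.loop k m

/-- The value recorded at level `j` of the current history, where outcomes are valued by the
weights `w`, and a return to the `k`-th element of the history is valued by `v k`. -/
def level (α : Alpha) (p : ℕ → ℝ) (w : Weights) (v : ℕ → ℝ) (j : ℕ) : ℝ :=
  w.goal * α.goal j + w.fail * α.fail j + w.noter * α.noter j +
    -- The entries of `α.loop` contain the likelihood of the path from `k` to `j - 1`. Dividing it
    -- out leaves the probability of returning to `k` given that `j - 1` has been reached,
    -- comparable with the other entries of level `j`. At `j = 0` the sum is empty, so the truncated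
    -- subtraction is harmless.
    ∑ k ∈ Finset.range j, α.loop k (j - 1) / pathProb p k (j - 1) * v k

theorem level_congr {α α' : Alpha} {p p' : ℕ → ℝ} {w : Weights} {v v' : ℕ → ℝ} {j : ℕ}
    (hg : α.goal j = α'.goal j) (hf : α.fail j = α'.fail j) (hn : α.noter j = α'.noter j)
    (hl : ∀ k < j, α.loop k (j - 1) = α'.loop k (j - 1))
    (hp : ∀ i < j, p i = p' i) (hv : ∀ i < j, v i = v' i) :
    α.level p w v j = α'.level p' w v' j := by
  unfold level
  rw [hg, hf, hn]
  congr 1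
  refine Finset.sum_congr rfl fun k hk => ?_
  have hk := Finset.mem_range.mp hk
  rw [hl k hk, hv k hk, pathProb_congr (p := p) (p' := p') fun i hi => hp i (by omega)]

/-- The value of reaching the last element `n` of the current history, as recorded so far. -/
def flow (α : Alpha) (p : ℕ → ℝ) (w : Weights) (v : ℕ → ℝ) (n : ℕ) : ℝ :=
  open Classical in
  -- In the first case all mass loops at `n` or never terminates. Otherwise the division sums the
  -- geometric series over the returns to `n`.
  if α.loop n n + α.noter (n + 1) = 1 then w.noter else
    (w.goal * α.goal (n + 1) + w.fail * α.fail (n + 1) + w.noter * α.noter (n + 1) +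
      ∑ k ∈ Finset.range n, α.loop k n / pathProb p k n * v k) / (1 - α.loop n n)

theorem flow_congr (α : Alpha) (p : ℕ → ℝ) (w : Weights) {v v' : ℕ → ℝ} {n : ℕ}
    (h : ∀ k < n, v k = v' k) : α.flow p w v n = α.flow p w v' n := by
  unfold flow
  rw [Finset.sum_congr rfl fun k hk => by rw [h k (Finset.mem_range.mp hk)]]

theorem level_succ (α : Alpha) (p : ℕ → ℝ) (w : Weights) (v : ℕ → ℝ) (n : ℕ) :
    α.level p w v (n + 1) =
      w.goal * α.goal (n + 1) + w.fail * α.fail (n + 1) + w.noter * α.noter (n + 1) +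
      ∑ k ∈ Finset.range n, α.loop k n / pathProb p k n * v k + α.loop n n * v n := by
  simp only [level, Nat.add_sub_cancel]
  rw [Finset.sum_range_succ, pathProb_self]
  ring

section Cumulate

variable {α : Alpha} {p : ℕ → ℝ} {n : ℕ}

theorem mass_succ (hmass : α.level p .one (fun _ => 1) (n + 1) ≤ 1) :
    α.goal (n + 1) + α.fail (n + 1) + α.noter (n + 1) +
      ∑ k ∈ Finset.range n, α.loop k n / pathProb p k n + α.loop n n ≤ 1 := by
  rw [level_succ] at hmass
  simpa [Weights.one] using hmass

theorem sum_loop_nonneg (hα : α.Nonneg) (hp : ∀ i ≤ n, 0 < p i) :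
    0 ≤ ∑ k ∈ Finset.range n, α.loop k n / pathProb p k n :=
  Finset.sum_nonneg fun _ _ => div_nonneg (hα.loop _ _) (pathProb_pos hp).le

theorem loop_le_one (hα : α.Nonneg) (hp : ∀ i ≤ n, 0 < p i)
    (hmass : α.level p .one (fun _ => 1) (n + 1) ≤ 1) : α.loop n n ≤ 1 := by
  linarith [mass_succ hmass, sum_loop_nonneg hα hp, hα.goal (n + 1), hα.fail (n + 1),
    hα.noter (n + 1)]

/-- A loop value of one would exhaust the mass of the level, hence force the excluded dead case. So
no division by zero occurs outside that case. -/
theorem loop_lt_one (hα : α.Nonneg) (hp : ∀ i ≤ n, 0 < p i)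
    (hmass : α.level p .one (fun _ => 1) (n + 1) ≤ 1)
    (hd : α.loop n n + α.noter (n + 1) ≠ 1) : α.loop n n < 1 := by
  have h1 := mass_succ hmass
  have h2 := sum_loop_nonneg hα hp
  have h3 := hα.goal (n + 1)
  have h4 := hα.fail (n + 1)
  have h5 := hα.noter (n + 1)
  have h6 := lt_of_le_of_ne (by linarith) hd
  linarith

/-- The loop at `n` and non-termination already use up the mass available at the level. -/
theorem eq_zero_of_dead (hα : α.Nonneg) (hp : ∀ i ≤ n, 0 < p i)
    (hmass : α.level p .one (fun _ => 1) (n + 1) ≤ 1)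
    (hd : α.loop n n + α.noter (n + 1) = 1) :
    α.goal (n + 1) = 0 ∧ α.fail (n + 1) = 0 ∧ ∀ k < n, α.loop k n = 0 := by
  have h1 := mass_succ hmass
  have h2 := sum_loop_nonneg hα hp
  have h3 := hα.goal (n + 1)
  have h4 := hα.fail (n + 1)
  refine ⟨by linarith, by linarith, fun k hk => ?_⟩
  have h5 : ∑ k ∈ Finset.range n, α.loop k n / pathProb p k n = 0 := by linarith
  have h6 := (Finset.sum_eq_zero_iff_of_nonneg fun k _ =>
    div_nonneg (hα.loop k n) (pathProb_pos hp).le).mp h5 k (Finset.mem_range.mpr hk)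
  exact (div_eq_zero_iff.mp h6).resolve_right (pathProb_pos hp).ne'

theorem nonneg_cumulateLast (hα : α.Nonneg) (hp : ∀ i ≤ n, 0 < p i)
    (hmass : α.level p .one (fun _ => 1) (n + 1) ≤ 1) : (cumulateLast p α n).Nonneg := by
  have hl := loop_le_one hα hp hmass
  have hn := (hp n le_rfl).le
  have hpos : 0 ≤ 1 - (open Classical in
      if α.loop n n + α.noter (n + 1) = 1 then 0 else α.loop n n) := by
    split_ifs <;> linarith
  constructor
  · intro k
    simp only [cumulateLast]
    split_ifs with h1 h2
    exacts [hα.goal k, add_nonneg (hα.goal n) (div_nonneg (mul_nonneg hn (hα.goal _)) (by simp)),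
      add_nonneg (hα.goal n) (div_nonneg (mul_nonneg hn (hα.goal _)) (by linarith)), le_rfl]
  · intro k
    simp only [cumulateLast]
    split_ifs with h1 h2
    exacts [hα.fail k, add_nonneg (hα.fail n) (div_nonneg (mul_nonneg hn (hα.fail _)) (by simp)),
      add_nonneg (hα.fail n) (div_nonneg (mul_nonneg hn (hα.fail _)) (by linarith)), le_rfl]
  · intro k
    simp only [cumulateLast]
    split_ifs with h1 h2
    exacts [hα.noter k, add_nonneg (hα.noter n) hn,
      add_nonneg (hα.noter n) (div_nonneg (mul_nonneg hn (hα.noter _)) (by linarith)), le_rfl]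
  · intro k m
    simp only [cumulateLast]
    split_ifs with h1 h2
    exacts [add_nonneg (hα.loop _ _) (div_nonneg (hα.loop _ _) (by simp)),
      add_nonneg (hα.loop _ _) (div_nonneg (hα.loop _ _) (by linarith)),
      add_nonneg (hα.loop _ _) le_rfl, le_rfl]

theorem level_cumulateLast_of_lt (w : Weights) (v : ℕ → ℝ) {j : ℕ} (hj : j < n) :
    (cumulateLast p α n).level p w v j = α.level p w v j := by
  refine level_congr ?_ ?_ ?_ (fun k hk => ?_) (fun _ _ => rfl) (fun _ _ => rfl)
  · simp [cumulateLast, hj]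
  · simp [cumulateLast, hj]
  · simp [cumulateLast, hj]
  · have h1 : k ≤ j - 1 ∧ j - 1 < n := by omega
    have h2 : ¬ (j - 1 + 1 = n) := by omega
    simp [cumulateLast, h1, h2]

/-- Loop entries move from column `n` to column `n - 1`, so they are divided by a path likelihood
lacking the factor `p n`. This is the same factor that the other outcomes receive explicitly, hence
the common `p n` before the flow. -/
theorem level_cumulateLast_self (hα : α.Nonneg) (hp : ∀ i ≤ n, 0 < p i)
    (hmass : α.level p .one (fun _ => 1) (n + 1) ≤ 1) (w : Weights) (v : ℕ → ℝ) :
    (cumulateLast p α n).level p w v n = α.level p w v n + p n * α.flow p w v n := by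
  have hpath : ∀ k < n, pathProb p k n = pathProb p k (n - 1) * p n := by
    intro k hk
    obtain ⟨m, rfl⟩ : ∃ m, n = m + 1 := ⟨n - 1, by omega⟩
    exact pathProb_succ p (by omega)
  by_cases hd : α.loop n n + α.noter (n + 1) = 1
  · obtain ⟨h1, h2, h3⟩ := eq_zero_of_dead hα hp hmass hd
    have hsum : ∑ k ∈ Finset.range n,
          (cumulateLast p α n).loop k (n - 1) / pathProb p k (n - 1) * v k =
        ∑ k ∈ Finset.range n, α.loop k (n - 1) / pathProb p k (n - 1) * v k := by
      refine Finset.sum_congr rfl fun k hk => ?_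
      have hk := Finset.mem_range.mp hk
      have h4 : k ≤ n - 1 ∧ n - 1 < n := by omega
      have h5 : n - 1 + 1 = n := by omega
      simp [cumulateLast, h4, h5, hd, h3 k hk]
    unfold level
    rw [hsum]
    simp [cumulateLast, flow, hd, h1, h2]
    ring
  · have hsum : ∑ k ∈ Finset.range n,
          (cumulateLast p α n).loop k (n - 1) / pathProb p k (n - 1) * v k =
        ∑ k ∈ Finset.range n, α.loop k (n - 1) / pathProb p k (n - 1) * v k +
        p n * (∑ k ∈ Finset.range n, α.loop k n / pathProb p k n * v k) / (1 - α.loop n n) := by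
      rw [Finset.mul_sum, Finset.sum_div, ← Finset.sum_add_distrib]
      refine Finset.sum_congr rfl fun k hk => ?_
      have hk := Finset.mem_range.mp hk
      have h4 : k ≤ n - 1 ∧ n - 1 < n := by omega
      have h5 : n - 1 + 1 = n := by omega
      have h6 : 1 - α.loop n n ≠ 0 := by linarith [loop_lt_one hα hp hmass hd]
      have h7 : pathProb p k (n - 1) ≠ 0 :=
        (pathProb_pos fun i hi => hp i (by omega)).ne'
      have h8 := (hp n le_rfl).ne'
      simp only [cumulateLast, h4, h5, hd, hpath k hk]
      simp
      field_simp
    unfold level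
    rw [hsum]
    simp [cumulateLast, flow, hd]
    ring

/-- Outside the dead case, the hypothesis has the form `A + l * v n ≤ v n`, which is solved for `v
n`. In the dead case the slack of `cap` is what puts `w.noter` below `v n`. -/
theorem flow_le (hα : α.Nonneg) (hp : ∀ i ≤ n, 0 < p i)
    (hmass : α.level p .one (fun _ => 1) (n + 1) ≤ 1) {w : Weights} {v : ℕ → ℝ}
    (h : α.level p w v (n + 1) ≤ w.cap (v n)) : α.flow p w v n ≤ v n := by
  rw [level_succ] at h
  unfold flow
  split_ifs with hd
  · obtain ⟨h1, h2, h3⟩ := eq_zero_of_dead hα hp hmass hd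
    have hsum : ∑ k ∈ Finset.range n, α.loop k n / pathProb p k n * v k = 0 :=
      Finset.sum_eq_zero fun k hk => by simp [h3 k (Finset.mem_range.mp hk)]
    refine w.noter_le_of_le_cap (loop_le_one hα hp hmass) ?_
    rw [hsum, h1, h2] at h
    rw [show 1 - α.loop n n = α.noter (n + 1) by linarith]
    linarith
  · rw [div_le_iff₀ (by linarith [loop_lt_one hα hp hmass hd])]
    linarith [w.cap_le (v n)]

theorem flow_one (hα : α.Nonneg) (hp : ∀ i ≤ n, 0 < p i)
    (hmass : α.level p .one (fun _ => 1) (n + 1) = 1) : α.flow p .one (fun _ => 1) n = 1 := by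
  unfold flow
  split_ifs with hd
  · rfl
  · rw [div_eq_one_iff_eq (by linarith [loop_lt_one hα hp hmass.le hd])]
    rw [level_succ] at hmass
    linarith

end Cumulate

end Alpha

-- Compatibility of CalcLambda with CumulateAlpha.

theorem lamBackward_congr {p p' : ℕ → ℝ} {α : Alpha} {L : ℕ} (h : ∀ k < L, p k = p' k) (i : ℕ)
    (hi : i ≤ L) : lamBackward p α L i = lamBackward p' α L i := by
  induction i with
  | zero => rfl
  | succ i ih =>
    simp only [lamBackward, lamStep, ih (by omega), h (L - (i + 1)) (by omega)]

/-- CumulateAlpha carries out the first backward step once and for all, and the remaining steps then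
see the same data. Consequently the values at the root are unchanged when the search returns from a
history element. -/
theorem lamBackward_cumulateLast (p : ℕ → ℝ) (α : Alpha) (n i : ℕ) (hi : i ≤ n) :
    (lamBackward p α (n + 1) (i + 1)).goal = (lamBackward p (cumulateLast p α n) n i).goal ∧
    (lamBackward p α (n + 1) (i + 1)).fail = (lamBackward p (cumulateLast p α n) n i).fail ∧
    (lamBackward p α (n + 1) (i + 1)).noter = (lamBackward p (cumulateLast p α n) n i).noter ∧
    (∀ j < n, (lamBackward p α (n + 1) (i + 1)).loop j =
      (lamBackward p (cumulateLast p α n) n i).loop j) ∧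
    (lamBackward p α (n + 1) (i + 1)).loop n =
      open Classical in
      if α.loop n n + α.noter (n + 1) = 1 then 0 else α.loop n n := by
  induction i with
  | zero =>
    simp only [lamBackward, lamStep, cumulateLast]
    by_cases hd : α.loop n n + α.noter (n + 1) = 1
    · simp [hd]
      exact ⟨add_comm _ _, add_comm _ _, add_comm _ _⟩
    · simp [hd]
      exact ⟨add_comm _ _, add_comm _ _, add_comm _ _, fun j hj => Function.update_of_ne hj.ne _ _⟩
  | succ i ih =>
    obtain ⟨h1, h2, h3, h4, h5⟩ := ih (by omega)
    rw [lamBackward, lamBackward.eq_2 p (cumulateLast p α n)]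
    generalize hk : n - (i + 1) = k
    have hk' : n + 1 - (i + 1 + 1) = k := by omega
    have hkn : k < n := by omega
    rw [hk']
    generalize lamBackward p α (n + 1) (i + 1) = a at *
    generalize lamBackward p (cumulateLast p α n) n i = b at *
    have hsum : ∑ m ∈ Finset.Ico k (n + 1), α.loop k m * ∏ j ∈ Finset.Ioc k m, (1 - a.loop j)⁻¹ =
        ∑ m ∈ Finset.Ico k n, (cumulateLast p α n).loop k m *
          ∏ j ∈ Finset.Ioc k m, (1 - b.loop j)⁻¹ := by
      obtain ⟨n, rfl⟩ : ∃ m, n = m + 1 := ⟨n - 1, by omega⟩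
      have hprod : ∀ m ≤ n, ∏ j ∈ Finset.Ioc k m, (1 - a.loop j)⁻¹ =
          ∏ j ∈ Finset.Ioc k m, (1 - b.loop j)⁻¹ := fun m hm =>
        Finset.prod_congr rfl fun j hj => by
          rw [h4 j (by have := (Finset.mem_Ioc.mp hj).2; omega)]
      have hkn : k ≤ n := by omega
      -- The two top terms of the longer sum, `m = n + 1` and `m = n`, merge into the top term of
      -- the shorter one: the factor of index `n + 1` is the divisor that CumulateAlpha applies to
      -- the last column.
      rw [Finset.sum_Ico_succ_top (by omega), Finset.sum_Ico_succ_top (by omega),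
        Finset.sum_Ico_succ_top (by omega),
        ← Finset.insert_Ioc_right_eq_Ioc_add_one hkn, Finset.prod_insert (by simp), h5,
        hprod n le_rfl]
      have hlow : ∑ m ∈ Finset.Ico k n, α.loop k m * ∏ j ∈ Finset.Ioc k m, (1 - a.loop j)⁻¹ =
          ∑ m ∈ Finset.Ico k n, (cumulateLast p α (n + 1)).loop k m *
            ∏ j ∈ Finset.Ioc k m, (1 - b.loop j)⁻¹ := by
        refine Finset.sum_congr rfl fun m hm => ?_
        have hm := Finset.mem_Ico.mp hm
        rw [hprod m (by omega)]
        have h6 : k ≤ m ∧ m < n + 1 := by omega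
        have h7 : ¬ (m = n) := by omega
        simp only [cumulateLast, h6, h7, add_left_inj, and_self, if_true, if_false, add_zero]
      rw [hlow]
      simp only [cumulateLast, hkn]
      simp
      ring
    simp only [lamStep]
    rw [hsum]
    have e1 : (cumulateLast p α n).goal k = α.goal k := by simp [cumulateLast, hkn]
    have e2 : (cumulateLast p α n).fail k = α.fail k := by simp [cumulateLast, hkn]
    have e3 : (cumulateLast p α n).noter k = α.noter k := by simp [cumulateLast, hkn]
    rw [e1, e2, e3, h1, h2, h3]
    have hup : ∀ x : ℝ, (∀ j < n, Function.update a.loop k x j = Function.update b.loop k x j) ∧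
        Function.update a.loop k x n =
          if α.loop n n + α.noter (n + 1) = 1 then 0 else α.loop n n := fun x =>
      ⟨fun j hj => by simp only [Function.update_apply, h4 j hj],
        by rw [Function.update_of_ne hkn.ne', h5]⟩
    generalize ∑ m ∈ Finset.Ico k n, (cumulateLast p α n).loop k m *
      ∏ j ∈ Finset.Ioc k m, (1 - b.loop j)⁻¹ = l
    by_cases hl : l + b.noter = 1
    · rw [if_pos hl, if_pos hl]
      exact ⟨rfl, rfl, rfl, hup 0⟩
    · rw [if_neg hl, if_neg hl]
      exact ⟨rfl, rfl, rfl, hup l⟩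

end Pandor

-- Extensions of partial controllers.

namespace FSC

variable {Q S A O : Type*}

/-- Every transition of `C` is a transition of `C'`, and the initial states agree. -/
structure Extends (C' C : FSC Q O A) : Prop where
  q₀ : C'.q₀ = C.q₀
  trans : ∀ q o l q', C.γ q o = some l → C.δ q o = some q' →
    C'.γ q o = some l ∧ C'.δ q o = some q'

theorem Extends.refl (C : FSC Q O A) : C.Extends C := ⟨rfl, fun _ _ _ _ h h' => ⟨h, h'⟩⟩

theorem Extends.comp {C C' C'' : FSC Q O A} (h' : C''.Extends C') (h : C'.Extends C) :
    C''.Extends C :=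
  ⟨h'.q₀.trans h.q₀, fun q o l q' h1 h2 =>
    h'.trans q o l q' (h.trans q o l q' h1 h2).1 (h.trans q o l q' h1 h2).2⟩

theorem extend_γ (C : FSC Q O A) (q : Q) (o : O) (l : Label A) (q' : Q) :
    (C.extend q o l q').γ q o = some l := by simp [extend]

theorem extend_δ (C : FSC Q O A) (q : Q) (o : O) (l : Label A) (q' : Q) :
    (C.extend q o l q').δ q o = some q' := by simp [extend]

theorem extend_of_ne (C : FSC Q O A) {q : Q} {o : O} (l : Label A) (q' : Q) {r : Q} {u : O}
    (h : ¬ (r = q ∧ u = o)) :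
    (C.extend q o l q').γ r u = C.γ r u ∧ (C.extend q o l q').δ r u = C.δ r u := by
  simp only [extend, Function.update_apply]
  by_cases h1 : r = q
  · have h2 : u ≠ o := fun h2 => h ⟨h1, h2⟩
    subst h1
    simp [h2]
  · simp [h1]

/-- A pair at which only one of `γ`, `δ` is defined carries no transition, so overwriting it loses
nothing. -/
theorem extends_extend (C : FSC Q O A) {q : Q} {o : O} (l : Label A) (q' : Q)
    (h : ∀ l q', C.γ q o = some l → C.δ q o ≠ some q') : (C.extend q o l q').Extends C := by
  refine ⟨rfl, fun r u l' r' h1 h2 => ?_⟩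
  by_cases h3 : r = q ∧ u = o
  · obtain ⟨rfl, rfl⟩ := h3
    exact absurd h2 (h _ _ h1)
  · rw [(C.extend_of_ne l q' h3).1, (C.extend_of_ne l q' h3).2]
    exact ⟨h1, h2⟩

theorem Extends.extend {C C' : FSC Q O A} (hC : C'.Extends C) {q : Q} {o : O} {l : Label A} {q' : Q}
    (h1 : C'.γ q o = some l) (h2 : C'.δ q o = some q') : C'.Extends (C.extend q o l q') := by
  refine ⟨hC.q₀, fun r u l' r' h3 h4 => ?_⟩
  by_cases h : r = q ∧ u = o
  · obtain ⟨rfl, rfl⟩ := h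
    rw [extend_γ] at h3
    rw [extend_δ] at h4
    exact ⟨h1.trans h3, h2.trans h4⟩
  · rw [(C.extend_of_ne l q' h).1] at h3
    rw [(C.extend_of_ne l q' h).2] at h4
    exact hC.trans _ _ _ _ h3 h4

/-- The controller executes an action in the combined state `x`. -/
def Acts (C : FSC Q O A) (E : Environment S A O) (x : Q × S) : Prop :=
  ∃ a q', C.γ x.1 (E.Ω x.2) = some (.act a) ∧ C.δ x.1 (E.Ω x.2) = some q'

theorem Acts.mono {C C' : FSC Q O A} (hC : C'.Extends C) {E : Environment S A O} {x : Q × S}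
    (h : C.Acts E x) : C'.Acts E x := by
  obtain ⟨a, q', h1, h2⟩ := h
  exact ⟨a, q', hC.trans _ _ _ _ h1 h2⟩

open Classical in
theorem stepProb_of_act {C : FSC Q O A} {E : Environment S A O} {x : Q × S} {a : A} {q' : Q}
    (h1 : C.γ x.1 (E.Ω x.2) = some (.act a)) (h2 : C.δ x.1 (E.Ω x.2) = some q') (y : Q × S) :
    C.stepProb E x y = if y.1 = q' then E.Δ x.2 a y.2 else 0 := by
  simp only [stepProb, h1, h2]

theorem stepProb_of_not_acts {C : FSC Q O A} {E : Environment S A O} {x : Q × S}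
    (h : ¬ C.Acts E x) (y : Q × S) : C.stepProb E x y = 0 := by
  unfold stepProb
  split
  · exact absurd ⟨_, _, ‹_›, ‹_›⟩ h
  · rfl

theorem stepProb_le_one (C : FSC Q O A) (E : Environment S A O) (x y : Q × S) :
    C.stepProb E x y ≤ 1 := by
  by_cases h : C.Acts E x
  · obtain ⟨a, q', h1, h2⟩ := h
    rw [stepProb_of_act h1 h2]
    split_ifs
    exacts [PMF.coe_le_one _ _, zero_le_one]
  · rw [stepProb_of_not_acts h]
    exact zero_le_one

theorem stepProb_extends {C C' : FSC Q O A} (hC : C'.Extends C) {E : Environment S A O} {x : Q × S}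
    (h : C.Acts E x) (y : Q × S) : C'.stepProb E x y = C.stepProb E x y := by
  obtain ⟨a, q', h1, h2⟩ := h
  obtain ⟨h3, h4⟩ := hC.trans _ _ _ _ h1 h2
  rw [stepProb_of_act h1 h2, stepProb_of_act h3 h4]

end FSC

namespace Pandor

variable {Q S A O : Type*}

-- Step probabilities along the current history.

section TransProb

variable {E : Environment S A O} {C : FSC Q O A} {h : List (Q × S)}

theorem transProb_succ {k : ℕ} {x y : Q × S} (hx : h[k]? = some x) (hy : h[k + 1]? = some y) :
    transProb E C h (k + 1) = (C.stepProb E x y).toReal := by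
  simp only [transProb, hx, hy]

theorem transProb_le_one (k : ℕ) : transProb E C h k ≤ 1 := by
  unfold transProb
  split
  · exact le_rfl
  · split
    · exact ENNReal.toReal_le_of_le_ofReal zero_le_one (by simpa using C.stepProb_le_one E _ _)
    · exact zero_le_one

theorem transProb_nonneg (k : ℕ) : 0 ≤ transProb E C h k := by
  unfold transProb
  split
  · exact zero_le_one
  · split
    · exact ENNReal.toReal_nonneg
    · exact le_rfl

theorem transProb_append {k : ℕ} (hk : k < h.length) (l : List (Q × S)) :
    transProb E C (h ++ l) k = transProb E C h k := by
  cases k with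
  | zero => rfl
  | succ k =>
    simp only [transProb]
    rw [List.getElem?_append_left (by omega), List.getElem?_append_left hk]

theorem transProb_extends {C' : FSC Q O A} (hC : C'.Extends C) {k : ℕ}
    (hacts : ∀ x ∈ h.take k, C.Acts E x) : transProb E C' h k = transProb E C h k := by
  cases k with
  | zero => rfl
  | succ k =>
    simp only [transProb]
    split
    · rename_i x y hx hy
      have hx' : x ∈ h.take (k + 1) := by
        refine List.mem_of_getElem? (i := k) ?_
        rw [List.getElem?_take, if_pos (by omega), hx]
      rw [FSC.stepProb_extends hC (hacts x hx')]
    · rfl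

theorem transProb_drop (k i : ℕ) : transProb E C (h.drop k) (i + 1) = transProb E C h (k + i + 1) := by
  simp only [transProb, List.getElem?_drop, Nat.add_assoc]

theorem likelihood_toReal (l : List (Q × S)) :
    (C.likelihood E l).toReal = ∏ i ∈ Finset.range (l.length - 1), transProb E C l (i + 1) := by
  match l with
  | [] => simp [FSC.likelihood]
  | [_] => simp [FSC.likelihood]
  | x :: y :: t =>
    have ih := likelihood_toReal (y :: t)
    simp only [FSC.likelihood, ENNReal.toReal_mul, ih, List.length_cons, Nat.add_sub_cancel]
    rw [Finset.prod_range_succ', mul_comm]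
    rfl

/-- Identifies the likelihood used in the loop test of the OR-step with the divisor in
`Alpha.level`, so that a recorded loop counts with the bare probability `p` of its closing step. -/
theorem likelihood_drop_toReal {k : ℕ} (hk : k < h.length) :
    (C.likelihood E (h.drop k)).toReal = pathProb (transProb E C h) k (h.length - 1) := by
  rw [likelihood_toReal, pathProb]
  have h1 : Finset.Ioc k (h.length - 1) = Finset.Ico (k + 1) h.length := by
    ext i
    simp only [Finset.mem_Ioc, Finset.mem_Ico]
    omega
  rw [h1, Finset.prod_Ico_eq_prod_range, List.length_drop, Nat.sub_sub]
  refine Finset.prod_congr rfl fun i _ => ?_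
  rw [transProb_drop, Nat.add_right_comm]

end TransProb

-- Admissible potentials.

/-- A potential `V` with respect to which the likelihoods found by a search, weighted by `w`, are
accounted for. -/
structure Admissible [Fintype S] (P : PlanningProblem S A O) (C : FSC Q O A) (w : Weights)
    (V : Q × S → ℝ) : Prop where
  nonneg : ∀ x, 0 ≤ V x
  act : ∀ q s a q', C.γ q (P.Ω s) = some (.act a) → C.δ q (P.Ω s) = some q' →
    ∑ s', (P.Δ s a s').toReal * V (q', s') ≤ w.cap (V (q, s))
  goal : ∀ q s q', C.γ q (P.Ω s) = some .halt → C.δ q (P.Ω s) = some q' → s ∈ P.G →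
    w.goal ≤ V (q, s)
  fail : ∀ q s q', C.γ q (P.Ω s) = some .halt → C.δ q (P.Ω s) = some q' → s ∉ P.G →
    w.fail ≤ V (q, s)

theorem Admissible.mono [Fintype S] {P : PlanningProblem S A O} {C C' : FSC Q O A} {w : Weights}
    {V : Q × S → ℝ} (hC : C'.Extends C) (h : Admissible P C' w V) : Admissible P C w V where
  nonneg := h.nonneg
  act q s a q' h1 h2 :=
    h.act q s a q' (hC.trans _ _ _ _ h1 h2).1 (hC.trans _ _ _ _ h1 h2).2
  goal q s q' h1 h2 :=
    h.goal q s q' (hC.trans _ _ _ _ h1 h2).1 (hC.trans _ _ _ _ h1 h2).2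
  fail q s q' h1 h2 :=
    h.fail q s q' (hC.trans _ _ _ _ h1 h2).1 (hC.trans _ _ _ _ h1 h2).2

theorem sum_toReal_pmf [Fintype S] (μ : PMF S) : ∑ s, (μ s).toReal = 1 := by
  rw [← ENNReal.toReal_sum fun s _ => PMF.apply_ne_top μ s, ← tsum_fintype (L := .unconditional _),
    PMF.tsum_coe, ENNReal.toReal_one]

/-- This potential counts total mass. Through the invariant it supplies the bound by one at each
level that the cumulation lemmas need. -/
theorem admissible_one [Fintype S] (P : PlanningProblem S A O) (C : FSC Q O A) :
    Admissible P C .one fun _ => 1 where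
  nonneg _ := zero_le_one
  act q s a q' _ _ := by simp [sum_toReal_pmf, Weights.cap_one]
  goal _ _ _ _ _ _ := le_rfl
  fail _ _ _ _ _ _ := le_rfl

/-- The values of `V` along the current history. -/
def along (V : Q × S → ℝ) (h : List (Q × S)) (k : ℕ) : ℝ := (h[k]?).elim 0 V

theorem along_append_left (V : Q × S → ℝ) {h : List (Q × S)} {k : ℕ} (hk : k < h.length)
    (l : List (Q × S)) : along V (h ++ l) k = along V h k := by
  simp only [along, List.getElem?_append_left hk]

theorem along_concat_length (V : Q × S → ℝ) (h : List (Q × S)) (x : Q × S) :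
    along V (h ++ [x]) h.length = V x := by simp [along]

theorem along_one {h : List (Q × S)} {k : ℕ} (hk : k < h.length) :
    along (fun _ : Q × S => (1 : ℝ)) h k = 1 := by simp [along, List.getElem?_eq_getElem hk]

/-- The bound on the total value at a level of the current history. -/
def ceiling (w : Weights) (V : Q × S → ℝ) (x₀ : Q × S) (h : List (Q × S)) : ℕ → ℝ
  | 0 => V x₀
  | k + 1 => w.cap (along V h k)

theorem ceiling_one (x₀ : Q × S) {h : List (Q × S)} {j : ℕ} (hj : j ≤ h.length) :
    ceiling .one (fun _ => 1) x₀ h j = 1 := by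
  cases j with
  | zero => rfl
  | succ j => rw [ceiling, along_one hj, Weights.cap_one]

theorem ceiling_append (w : Weights) (V : Q × S → ℝ) (x₀ : Q × S) {h : List (Q × S)} {j : ℕ}
    (hj : j ≤ h.length) (l : List (Q × S)) :
    ceiling w V x₀ (h ++ l) j = ceiling w V x₀ h j := by
  cases j with
  | zero => rfl
  | succ j => rw [ceiling, ceiling, along_append_left V hj]

/-- The value of a list of outcomes that remain to be tested. -/
def pendingValue (V : Q × S → ℝ) (R : List ((Q × S) × ℝ)) : ℝ := (R.map fun e => e.2 * V e.1).sum

theorem pendingValue_nonneg {V : Q × S → ℝ} (hV : ∀ x, 0 ≤ V x) {R : List ((Q × S) × ℝ)}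
    (hR : ∀ e ∈ R, 0 ≤ e.2) : 0 ≤ pendingValue V R :=
  List.sum_nonneg fun _ he => by
    obtain ⟨e, he', rfl⟩ := List.mem_map.mp he
    exact mul_nonneg (hR e he') (hV _)

-- The invariant of the search and its stability under CumulateAlpha.

section Invariant

/-- The total value at level `j` of the current history `h`, when `R j` are the outcomes at this
level that remain to be tested. -/
def load (E : Environment S A O) (C : FSC Q O A) (h : List (Q × S)) (α : Alpha)
    (R : ℕ → List ((Q × S) × ℝ)) (w : Weights) (V : Q × S → ℝ) (j : ℕ) : ℝ :=
  pendingValue V (R j) + (if j < h.length then transProb E C h j * along V h j else 0) +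
    α.level (transProb E C h) w (along V h) j

variable {C : FSC Q O A} {h : List (Q × S)} {α : Alpha} {R : ℕ → List ((Q × S) × ℝ)}

/-- The values computed by CalcLambda satisfy the success condition of the search. -/
def Success (E : Environment S A O) (LTERstar LGTstar : ℝ) (C : FSC Q O A) (h : List (Q × S))
    (α : Alpha) : Prop :=
  LGTstar ≤ (calcLambda E C h α).goal ∧
    LTERstar ≤ (calcLambda E C h α).goal + (calcLambda E C h α).fail

theorem load_congr_pending {E : Environment S A O} {R' : ℕ → List ((Q × S) × ℝ)} {w : Weights}
    {V : Q × S → ℝ} {j : ℕ} (hR : R j = R' j) : load E C h α R w V j = load E C h α R' w V j := by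
  rw [load, hR, load]

theorem transProb_eq_of_extends {E : Environment S A O} {C' : FSC Q O A} (hC : C'.Extends C)
    (hacts : ∀ x ∈ h, C.Acts E x) : transProb E C' h = transProb E C h :=
  funext fun _ => transProb_extends hC fun x hx => hacts x (List.mem_of_mem_take hx)

theorem load_extends {E : Environment S A O} {C' : FSC Q O A} (hC : C'.Extends C)
    (hacts : ∀ x ∈ h, C.Acts E x) (w : Weights) (V : Q × S → ℝ) (j : ℕ) :
    load E C' h α R w V j = load E C h α R w V j := by
  rw [load, transProb_eq_of_extends hC hacts, load]

theorem level_append (α : Alpha) (E : Environment S A O) (w : Weights) (V : Q × S → ℝ) {j : ℕ}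
    (hj : j ≤ h.length) (l : List (Q × S)) :
    α.level (transProb E C (h ++ l)) w (along V (h ++ l)) j =
      α.level (transProb E C h) w (along V h) j :=
  Alpha.level_congr rfl rfl rfl (fun _ _ => rfl) (fun _ hi => transProb_append (by omega) l)
    fun _ hi => along_append_left V (by omega) l

theorem cumulateAlpha_concat (E : Environment S A O) (C : FSC Q O A) (h : List (Q × S)) (x : Q × S)
    (α : Alpha) : cumulateAlpha E C (h ++ [x]) α =
      cumulateLast (transProb E C (h ++ [x])) α h.length := by
  have hlen : (h ++ [x]).length = h.length + 1 := by simp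
  unfold cumulateAlpha
  rw [hlen]

theorem calcLambda_cumulateAlpha (E : Environment S A O) (C : FSC Q O A) (h : List (Q × S))
    (α : Alpha) :
    (calcLambda E C h.dropLast (cumulateAlpha E C h α)).goal = (calcLambda E C h α).goal ∧
    (calcLambda E C h.dropLast (cumulateAlpha E C h α)).fail = (calcLambda E C h α).fail ∧
    (calcLambda E C h.dropLast (cumulateAlpha E C h α)).noter = (calcLambda E C h α).noter := by
  rcases List.eq_nil_or_concat' h with rfl | ⟨h, x, rfl⟩
  · exact ⟨rfl, rfl, rfl⟩
  · rw [List.dropLast_concat, cumulateAlpha_concat, calcLambda, calcLambda, List.length_append,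
      List.length_singleton]
    rw [← lamBackward_congr (p := transProb E C (h ++ [x])) (fun k hk => transProb_append hk [x]) _
      le_rfl]
    obtain ⟨h1, h2, h3, -⟩ :=
      lamBackward_cumulateLast (transProb E C (h ++ [x])) α h.length h.length le_rfl
    exact ⟨h1.symm, h2.symm, h3.symm⟩

theorem Success.cumulateAlpha {E : Environment S A O} {LTERstar LGTstar : ℝ}
    (hS : Success E LTERstar LGTstar C h α) :
    Success E LTERstar LGTstar C h.dropLast (cumulateAlpha E C h α) := by
  obtain ⟨h1, h2, -⟩ := calcLambda_cumulateAlpha E C h α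
  rw [Success, h1, h2]
  exact hS

/-- At every level of the current history, the likelihoods sum up to one. -/
def Exhaustive (P : PlanningProblem S A O) (C : FSC Q O A) (h : List (Q × S)) (α : Alpha)
    (R : ℕ → List ((Q × S) × ℝ)) : Prop :=
  ∀ j ≤ h.length, load P.toEnvironment C h α R .one (fun _ => 1) j = 1

variable {P : PlanningProblem S A O} {x₀ : Q × S}

theorem Exhaustive.congr_pending {R' : ℕ → List ((Q × S) × ℝ)}
    (hI : Exhaustive P C h α R) (hR : ∀ j ≤ h.length, R j = R' j) : Exhaustive P C h α R' :=
  fun j hj => by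
    rw [← load_congr_pending (hR j hj)]
    exact hI j hj

theorem Exhaustive.extends {C' : FSC Q O A} (hC : C'.Extends C)
    (hacts : ∀ x ∈ h, C.Acts P.toEnvironment x) (hI : Exhaustive P C h α R) :
    Exhaustive P C' h α R := fun j hj => by
  rw [load_extends hC hacts]
  exact hI j hj

variable [Fintype S]

/-- The invariant of the search: all the likelihoods kept are accounted for by every admissible
potential. -/
structure Invariant (P : PlanningProblem S A O) (x₀ : Q × S) (C : FSC Q O A) (h : List (Q × S)) (α : Alpha)
    (R : ℕ → List ((Q × S) × ℝ)) : Prop where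
  nonneg : α.Nonneg
  pos : ∀ j < h.length, 0 < transProb P.toEnvironment C h j
  acts : ∀ x ∈ h, C.Acts P.toEnvironment x
  pending : ∀ j, ∀ e ∈ R j, 0 ≤ e.2
  load_le : ∀ w V, Admissible P C w V → ∀ j ≤ h.length,
    load P.toEnvironment C h α R w V j ≤ ceiling w V x₀ h j

theorem Invariant.congr_pending {R' : ℕ → List ((Q × S) × ℝ)}
    (hI : Invariant P x₀ C h α R) (hR : ∀ j ≤ h.length, R j = R' j)
    (hR' : ∀ j, ∀ e ∈ R' j, 0 ≤ e.2) : Invariant P x₀ C h α R' where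
  nonneg := hI.nonneg
  pos := hI.pos
  acts := hI.acts
  pending := hR'
  load_le w V hV j hj := by
    rw [← load_congr_pending (hR j hj)]
    exact hI.load_le w V hV j hj

theorem Invariant.extends {C' : FSC Q O A} (hC : C'.Extends C) (hI : Invariant P x₀ C h α R) :
    Invariant P x₀ C' h α R where
  nonneg := hI.nonneg
  pos := by
    rw [transProb_eq_of_extends hC hI.acts]
    exact hI.pos
  acts x hx := (hI.acts x hx).mono hC
  pending := hI.pending
  load_le w V hV j hj := by
    rw [load_extends hC hI.acts]
    exact hI.load_le w V (hV.mono hC) j hj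

theorem Invariant.level_le_one (hI : Invariant P x₀ C h α R) {n : ℕ} (hn : h.length = n + 1) :
    α.level (transProb P.toEnvironment C h) .one (fun _ => 1) (n + 1) ≤ 1 := by
  have h1 := hI.load_le .one _ (admissible_one P C) (n + 1) hn.ge
  have h2 := pendingValue_nonneg (fun _ => zero_le_one) (hI.pending (n + 1))
  rw [ceiling_one x₀ hn.ge, load, if_neg (by omega)] at h1
  rw [Alpha.level_congr (v' := fun _ => 1) rfl rfl rfl (fun _ _ => rfl) (fun _ _ => rfl)
    fun i hi => along_one (by omega)] at h1
  linarith

/-- Only the level of the removed element changes: its estimate `V x` is replaced by the value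
actually found behind it, the flow. -/
theorem load_cumulate {x : Q × S} (hI : Invariant P x₀ C (h ++ [x]) α R) (w : Weights)
    (V : Q × S → ℝ) {j : ℕ} (hj : j ≤ h.length) :
    load P.toEnvironment C h (cumulateLast (transProb P.toEnvironment C (h ++ [x])) α h.length) R
        w V j =
      load P.toEnvironment C (h ++ [x]) α R w V j -
        if j = h.length then transProb P.toEnvironment C (h ++ [x]) j *
          (V x - α.flow (transProb P.toEnvironment C (h ++ [x])) w (along V (h ++ [x])) j)
        else 0 := by
  have hlen : (h ++ [x]).length = h.length + 1 := by simp
  have hmass := hI.level_le_one hlen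
  have hp : ∀ i ≤ h.length, 0 < transProb P.toEnvironment C (h ++ [x]) i := fun i hi =>
    hI.pos i (by omega)
  rw [load, load, ← level_append _ _ _ _ hj [x]]
  rcases hj.lt_or_eq with hj | rfl
  · rw [Alpha.level_cumulateLast_of_lt _ _ hj, if_pos hj, if_pos (by omega), if_neg hj.ne,
      transProb_append hj, along_append_left V hj, sub_zero]
  · rw [Alpha.level_cumulateLast_self hI.nonneg hp hmass, if_neg (lt_irrefl _),
      if_pos (by omega), if_pos rfl, along_concat_length]
    ring

theorem Invariant.cumulate {x : Q × S} (hI : Invariant P x₀ C (h ++ [x]) α R) :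
    Invariant P x₀ C h
      (cumulateLast (transProb P.toEnvironment C (h ++ [x])) α h.length) R := by
  have hlen : (h ++ [x]).length = h.length + 1 := by simp
  have hmass := hI.level_le_one hlen
  have hp : ∀ i ≤ h.length, 0 < transProb P.toEnvironment C (h ++ [x]) i := fun i hi =>
    hI.pos i (by omega)
  refine ⟨Alpha.nonneg_cumulateLast hI.nonneg hp hmass, fun j hj => ?_,
    fun y hy => hI.acts y (by simp [hy]), hI.pending, fun w V hV j hj => ?_⟩
  · rw [← transProb_append hj [x]]
    exact hp j hj.le
  · rw [load_cumulate hI w V hj, ← ceiling_append w V x₀ hj [x]]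
    have h1 := hI.load_le w V hV j (by omega)
    split_ifs with h2
    · subst h2
      have h2 := hI.load_le w V hV (h.length + 1) (by omega)
      have h3 := pendingValue_nonneg hV.nonneg (hI.pending (h.length + 1))
      rw [ceiling, load, if_neg (by omega)] at h2
      -- The invariant one level higher bounds the flow by `V x`, so the replacement can only lower
      -- the load.
      have h4 := Alpha.flow_le hI.nonneg hp hmass (w := w) (v := along V (h ++ [x])) (by linarith)
      rw [along_concat_length] at h4
      nlinarith [hp h.length le_rfl]
    · linarith

/-- With nothing pending at the top level its mass is fully recorded, so the flow equals one and
replacing `V x = 1` by it changes nothing. -/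
theorem Exhaustive.cumulate {x : Q × S} (hI : Invariant P x₀ C (h ++ [x]) α R)
    (hE : Exhaustive P C (h ++ [x]) α R) (hR : R (h.length + 1) = []) :
    Exhaustive P C h
      (cumulateLast (transProb P.toEnvironment C (h ++ [x])) α h.length) R := by
  have hlen : (h ++ [x]).length = h.length + 1 := by simp
  have hp : ∀ i ≤ h.length, 0 < transProb P.toEnvironment C (h ++ [x]) i := fun i hi =>
    hI.pos i (by omega)
  intro j hj
  rw [load_cumulate hI _ _ hj, hE j (by omega)]
  split_ifs with h2
  · subst h2
    have h2 := hE (h.length + 1) (by omega)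
    have hcongr : ∀ j ≤ h.length + 1, ∀ i < j,
        along (fun _ : Q × S => (1 : ℝ)) (h ++ [x]) i = 1 := fun j hj i hi => along_one (by omega)
    rw [load, if_neg (by omega), hR,
      Alpha.level_congr (v' := fun _ => 1) rfl rfl rfl (fun _ _ => rfl) (fun _ _ => rfl)
        (hcongr _ le_rfl)] at h2
    have h3 := Alpha.flow_one hI.nonneg hp (by simpa [pendingValue] using h2)
    have h4 := (α.flow_congr (transProb P.toEnvironment C (h ++ [x])) .one
      (hcongr h.length (by omega))).trans h3
    rw [h4]
    ring
  · ring

theorem Invariant.cumulateAlpha (hI : Invariant P x₀ C h α R) :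
    Invariant P x₀ C h.dropLast (cumulateAlpha P.toEnvironment C h α) R := by
  rcases List.eq_nil_or_concat' h with rfl | ⟨h, x, rfl⟩
  · exact hI
  · rw [List.dropLast_concat, cumulateAlpha_concat]
    exact hI.cumulate

theorem Exhaustive.cumulateAlpha (hI : Invariant P x₀ C h α R) (hE : Exhaustive P C h α R)
    (hR : R h.length = []) :
    Exhaustive P C h.dropLast (cumulateAlpha P.toEnvironment C h α) R := by
  rcases List.eq_nil_or_concat' h with rfl | ⟨h, x, rfl⟩
  · exact hE
  · rw [List.dropLast_concat, cumulateAlpha_concat]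
    exact hE.cumulate hI (by simpa using hR)

/-- Every admissible potential bounds the weighted likelihoods computed by CalcLambda. -/
theorem Invariant.calcLambda_le (hI : Invariant P x₀ C h α R) {w : Weights} {V : Q × S → ℝ}
    (hV : Admissible P C w V) :
    w.goal * (calcLambda P.toEnvironment C h α).goal +
      w.fail * (calcLambda P.toEnvironment C h α).fail +
      w.noter * (calcLambda P.toEnvironment C h α).noter ≤ V x₀ := by
  induction h using List.reverseRecOn generalizing α with
  | nil =>
    have h1 := hI.load_le w V hV 0 le_rfl
    have h2 := pendingValue_nonneg hV.nonneg (hI.pending 0)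
    simp [load, Alpha.level, ceiling] at h1
    simp only [calcLambda, lamBackward, List.length_nil]
    linarith
  | append_singleton h x ih =>
    -- Cumulating the last element keeps both the invariant and the `λ` values. At the empty history
    -- the invariant at level `0` is the claim.
    have h1 := ih hI.cumulate
    obtain ⟨h2, h3, h4⟩ := calcLambda_cumulateAlpha P.toEnvironment C (h ++ [x]) α
    rw [List.dropLast_concat, cumulateAlpha_concat] at h2 h3 h4
    rwa [h2, h3, h4] at h1

end Invariant

-- Effect of the individual updates of the search.

namespace Alpha

variable {α : Alpha} {p v : ℕ → ℝ} {w : Weights} {j L : ℕ}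

theorem level_nonneg (hα : α.Nonneg) (hp : ∀ i < j, 0 < p i) (hv : ∀ i, 0 ≤ v i) :
    0 ≤ α.level p w v j := by
  have h1 := mul_nonneg w.goal_nonneg (hα.goal j)
  have h2 := mul_nonneg w.fail_nonneg (hα.fail j)
  have h3 := mul_nonneg w.noter_nonneg (hα.noter j)
  have h4 : 0 ≤ ∑ k ∈ Finset.range j, α.loop k (j - 1) / pathProb p k (j - 1) * v k := by
    refine Finset.sum_nonneg fun k hk => mul_nonneg (div_nonneg (hα.loop _ _) ?_) (hv k)
    have hk := Finset.mem_range.mp hk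
    exact (pathProb_pos fun i hi => hp i (by omega)).le
  unfold level
  linarith

theorem nonneg_update {f : ℕ → ℝ} (hf : ∀ k, 0 ≤ f k) {x : ℝ} (hx : 0 ≤ x) (i k : ℕ) :
    0 ≤ Function.update f i x k := by
  rw [Function.update_apply]
  split_ifs
  exacts [hx, hf k]

theorem Nonneg.addGoal (hα : α.Nonneg) {x : ℝ} (hx : 0 ≤ x) : (α.addGoal L x).Nonneg :=
  ⟨nonneg_update hα.goal (add_nonneg (hα.goal L) hx) L, hα.fail, hα.noter, hα.loop⟩

theorem Nonneg.addFail (hα : α.Nonneg) {x : ℝ} (hx : 0 ≤ x) : (α.addFail L x).Nonneg :=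
  ⟨hα.goal, nonneg_update hα.fail (add_nonneg (hα.fail L) hx) L, hα.noter, hα.loop⟩

theorem Nonneg.addNoter (hα : α.Nonneg) {x : ℝ} (hx : 0 ≤ x) : (α.addNoter L x).Nonneg :=
  ⟨hα.goal, hα.fail, nonneg_update hα.noter (add_nonneg (hα.noter L) hx) L, hα.loop⟩

theorem Nonneg.addLoop (hα : α.Nonneg) {k m : ℕ} {x : ℝ} (hx : 0 ≤ x) :
    (α.addLoop k m x).Nonneg := by
  refine ⟨hα.goal, hα.fail, hα.noter, fun i j => ?_⟩
  simp only [Alpha.addLoop, Function.update_apply]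
  split_ifs with h1
  · exact nonneg_update (hα.loop k) (add_nonneg (hα.loop k m) hx) m j
  · exact hα.loop i j

theorem Nonneg.grow (hα : α.Nonneg) : (α.grow L).Nonneg := by
  refine ⟨nonneg_update hα.goal le_rfl _, nonneg_update hα.fail le_rfl _,
    nonneg_update hα.noter le_rfl _, fun i j => ?_⟩
  simp only [Alpha.grow]
  split_ifs
  exacts [le_rfl, hα.loop i j]

theorem level_addGoal (x : ℝ) :
    (α.addGoal L x).level p w v j = α.level p w v j + if j = L then w.goal * x else 0 := by
  simp only [level, addGoal, Function.update_apply]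
  split_ifs with h
  · rw [h]; ring
  · ring

theorem level_addFail (x : ℝ) :
    (α.addFail L x).level p w v j = α.level p w v j + if j = L then w.fail * x else 0 := by
  simp only [level, addFail, Function.update_apply]
  split_ifs with h
  · rw [h]; ring
  · ring

theorem level_addNoter (x : ℝ) :
    (α.addNoter L x).level p w v j = α.level p w v j + if j = L then w.noter * x else 0 := by
  simp only [level, addNoter, Function.update_apply]
  split_ifs with h
  · rw [h]; ring
  · ring

theorem level_addLoop {k : ℕ} (hk : k < L) (x : ℝ) :
    (α.addLoop k (L - 1) x).level p w v j = α.level p w v j +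
      if j = L then x / pathProb p k (L - 1) * v k else 0 := by
  have hloop : ∀ i m, (α.addLoop k (L - 1) x).loop i m =
      α.loop i m + if i = k ∧ m = L - 1 then x else 0 := by
    intro i m
    simp only [addLoop, Function.update_apply]
    by_cases h1 : i = k
    · subst h1
      by_cases h2 : m = L - 1
      · simp [h2]
      · simp [h2]
    · simp [h1]
  have hsum : ∑ i ∈ Finset.range j,
        (α.addLoop k (L - 1) x).loop i (j - 1) / pathProb p i (j - 1) * v i =
      ∑ i ∈ Finset.range j, α.loop i (j - 1) / pathProb p i (j - 1) * v i +
        if j = L then x / pathProb p k (L - 1) * v k else 0 := by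
    simp only [hloop, add_div, add_mul, Finset.sum_add_distrib]
    congr 1
    split_ifs with h
    · subst h
      rw [Finset.sum_eq_single_of_mem k (Finset.mem_range.mpr hk)]
      · simp
      · intro i _ hi
        simp [hi]
    · refine Finset.sum_eq_zero fun i hi => ?_
      have hi := Finset.mem_range.mp hi
      rw [if_neg (by omega)]
      simp
  unfold level
  rw [hsum, ← add_assoc]
  rfl

theorem level_grow_of_le (hj : j ≤ L) : (α.grow L).level p w v j = α.level p w v j := by
  refine level_congr ?_ ?_ ?_ (fun k hk => ?_) (fun _ _ => rfl) (fun _ _ => rfl)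
  · exact Function.update_of_ne (by omega) _ _
  · exact Function.update_of_ne (by omega) _ _
  · exact Function.update_of_ne (by omega) _ _
  · simp only [grow]
    rw [if_neg (by omega)]

theorem level_grow_succ : (α.grow L).level p w v (L + 1) = 0 := by
  simp [level, grow]

end Alpha

theorem pendingValue_nil (V : Q × S → ℝ) : pendingValue V [] = 0 := rfl

theorem pendingValue_cons (V : Q × S → ℝ) (e : (Q × S) × ℝ) (R : List ((Q × S) × ℝ)) :
    pendingValue V (e :: R) = e.2 * V e.1 + pendingValue V R := by simp [pendingValue]

theorem along_nonneg {V : Q × S → ℝ} (hV : ∀ x, 0 ≤ V x) (h : List (Q × S)) (k : ℕ) :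
    0 ≤ along V h k := by
  unfold along
  cases h[k]?
  exacts [le_rfl, hV _]

section Updates

variable {E : Environment S A O} {P : PlanningProblem S A O} {x₀ : Q × S} {C : FSC Q O A}
  {h : List (Q × S)} {α : Alpha} {R : ℕ → List ((Q × S) × ℝ)} {x : Q × S} {p : ℝ}
  {rest : List ((Q × S) × ℝ)}

/-- The first pending outcome, worth `p * V x`, is exchanged for a recorded value `d`. The invariant
survives if `d ≤ p * V x`, and exhaustiveness if both are equal. -/
theorem load_settle {α' : Alpha} (hR : R h.length = (x, p) :: rest) {w : Weights} {V : Q × S → ℝ}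
    {d : ℝ} {j : ℕ} (hlevel : α'.level (transProb E C h) w (along V h) j =
      α.level (transProb E C h) w (along V h) j + if j = h.length then d else 0) :
    load E C h α' (Function.update R h.length rest) w V j =
      load E C h α R w V j + if j = h.length then d - p * V x else 0 := by
  rw [load, load, hlevel]
  by_cases h1 : j = h.length
  · subst h1
    rw [Function.update_self, hR, pendingValue_cons, if_pos rfl, if_pos rfl]
    ring
  · rw [Function.update_of_ne h1, if_neg h1, if_neg h1]
    ring

/-- The share `p * V x` merely moves from the pending outcomes to the term for the next history
element, so the old levels keep their load. -/
theorem load_push (hR : R h.length = (x, p) :: rest)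
    (hx : transProb E C (h ++ [x]) h.length = p) (outs : List ((Q × S) × ℝ)) (w : Weights)
    (V : Q × S → ℝ) {j : ℕ} (hj : j ≤ h.length + 1) :
    load E C (h ++ [x]) (α.grow h.length)
        (Function.update (Function.update R h.length rest) (h.length + 1) outs) w V j =
      if j = h.length + 1 then pendingValue V outs else load E C h α R w V j := by
  have hlen : (h ++ [x]).length = h.length + 1 := by simp
  split_ifs with h1
  · subst h1
    rw [load, Function.update_self, Alpha.level_grow_succ, if_neg (by omega)]
    ring
  · have hj : j ≤ h.length := by omega
    rw [load, load, Function.update_of_ne h1, Alpha.level_grow_of_le hj, level_append _ _ _ _ hj,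
      if_pos (by omega)]
    rcases hj.lt_or_eq with h2 | rfl
    · rw [Function.update_of_ne h2.ne, if_pos h2, transProb_append h2, along_append_left V h2]
    · rw [Function.update_self, if_neg (lt_irrefl _), hx, along_concat_length, hR,
        pendingValue_cons]
      ring

theorem Exhaustive.settle {α' : Alpha} (hE : Exhaustive P C h α R)
    (hR : R h.length = (x, p) :: rest)
    (hlevel : ∀ j, α'.level (transProb P.toEnvironment C h) .one (along (fun _ => 1) h) j =
      α.level (transProb P.toEnvironment C h) .one (along (fun _ => 1) h) j +
        if j = h.length then p else 0) :
    Exhaustive P C h α' (Function.update R h.length rest) := fun j hj => by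
  rw [load_settle hR (hlevel j), hE j hj]
  simp

theorem Exhaustive.push (hE : Exhaustive P C h α R) (hR : R h.length = (x, p) :: rest)
    (hx : transProb P.toEnvironment C (h ++ [x]) h.length = p) {outs : List ((Q × S) × ℝ)}
    (hval : pendingValue (fun _ => 1) outs = 1) :
    Exhaustive P C (h ++ [x]) (α.grow h.length)
      (Function.update (Function.update R h.length rest) (h.length + 1) outs) := fun j hj => by
  have hlen : (h ++ [x]).length = h.length + 1 := by simp
  rw [load_push hR hx outs _ _ (by omega)]
  split_ifs
  exacts [hval, hE j (by omega)]

variable [Fintype S]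

theorem Invariant.settle {α' : Alpha} (hI : Invariant P x₀ C h α R)
    (hR : R h.length = (x, p) :: rest) (hα' : α'.Nonneg) (d : Weights → (Q × S → ℝ) → ℝ)
    (hlevel : ∀ w V j, α'.level (transProb P.toEnvironment C h) w (along V h) j =
      α.level (transProb P.toEnvironment C h) w (along V h) j +
        if j = h.length then d w V else 0)
    (hd : ∀ w V, Admissible P C w V → d w V ≤ p * V x) :
    Invariant P x₀ C h α' (Function.update R h.length rest) where
  nonneg := hα'
  pos := hI.pos
  acts := hI.acts
  pending j e he := by
    rcases eq_or_ne j h.length with rfl | hj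
    · rw [Function.update_self] at he
      exact hI.pending h.length e (by rw [hR]; exact List.mem_cons_of_mem _ he)
    · rw [Function.update_of_ne hj] at he
      exact hI.pending j e he
  load_le w V hV j hj := by
    rw [load_settle hR (hlevel w V j)]
    have h1 := hI.load_le w V hV j hj
    have h2 := hd w V hV
    split_ifs <;> linarith

theorem Invariant.push (hI : Invariant P x₀ C h α R)
    (hR : R h.length = (x, p) :: rest) (hp : 0 < p)
    (hx : transProb P.toEnvironment C (h ++ [x]) h.length = p)
    (hacts : C.Acts P.toEnvironment x) {outs : List ((Q × S) × ℝ)} (houts : ∀ e ∈ outs, 0 ≤ e.2)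
    (hval : ∀ w V, Admissible P C w V → pendingValue V outs ≤ w.cap (V x)) :
    Invariant P x₀ C (h ++ [x]) (α.grow h.length)
      (Function.update (Function.update R h.length rest) (h.length + 1) outs) where
  nonneg := hI.nonneg.grow
  pos j hj := by
    rw [List.length_append, List.length_singleton] at hj
    rcases (Nat.lt_succ_iff.mp hj).lt_or_eq with h1 | rfl
    · rw [transProb_append h1]
      exact hI.pos j h1
    · rwa [hx]
  acts y hy := by
    rcases List.mem_append.mp hy with h1 | h1
    · exact hI.acts y h1
    · rwa [List.mem_singleton.mp h1]
  pending j e he := by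
    rcases eq_or_ne j (h.length + 1) with rfl | hj
    · rw [Function.update_self] at he
      exact houts e he
    rw [Function.update_of_ne hj] at he
    rcases eq_or_ne j h.length with rfl | hj
    · rw [Function.update_self] at he
      exact hI.pending h.length e (by rw [hR]; exact List.mem_cons_of_mem _ he)
    · rw [Function.update_of_ne hj] at he
      exact hI.pending j e he
  load_le w V hV j hj := by
    rw [List.length_append, List.length_singleton] at hj
    rw [load_push hR hx outs _ _ hj]
    split_ifs with h1
    · rw [h1, ceiling, along_concat_length]
      exact hval w V hV
    · rw [ceiling_append _ _ _ (by omega)]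
      exact hI.load_le w V hV j (by omega)

/-- All steps of the cycle have probability one, so the invariant makes `V` nonincreasing along it,
while closing the cycle gives `V x` at most the `cap` of the last value. Such a return without loss
is only possible if `V` is at least `w.noter` there. -/
theorem Invariant.noter_le_of_cycle (hI : Invariant P x₀ C h α R)
    (hR : R h.length = (x, p) :: rest) {k : ℕ} (hk : h[k]? = some x) (hp : 1 ≤ p)
    (hpath : 1 ≤ pathProb (transProb P.toEnvironment C h) k (h.length - 1)) {w : Weights}
    {V : Q × S → ℝ} (hV : Admissible P C w V) : w.noter ≤ V x := by
  have hkL : k < h.length := (List.getElem?_eq_some_iff.mp hk).1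
  have hvk : along V h k = V x := by simp [along, hk]
  have hv := along_nonneg hV.nonneg h
  have hlevel : ∀ j ≤ h.length,
      0 ≤ α.level (transProb P.toEnvironment C h) w (along V h) j := fun j hj =>
    Alpha.level_nonneg hI.nonneg (fun i hi => hI.pos i (by omega)) hv
  have hdesc : ∀ m, k ≤ m → m < h.length →
      1 ≤ pathProb (transProb P.toEnvironment C h) k m → along V h m ≤ along V h k := by
    intro m hkm
    induction m, hkm using Nat.le_induction with
    | base => exact fun _ _ => le_rfl
    | succ m hkm ih =>
      intro hm h1
      have h2 : transProb P.toEnvironment C h (m + 1) ≤ 1 := transProb_le_one _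
      have h3 := hI.pos (m + 1) hm
      have h4 : 0 < pathProb (transProb P.toEnvironment C h) k m :=
        pathProb_pos fun i hi => hI.pos i (by omega)
      have h4' : pathProb (transProb P.toEnvironment C h) k m ≤ 1 :=
        Finset.prod_le_one (fun i _ => transProb_nonneg i) fun i _ => transProb_le_one i
      rw [pathProb_succ _ hkm] at h1
      have h5 := ih (by omega) (by nlinarith)
      have h6 := hI.load_le w V hV (m + 1) hm.le
      have h7 := pendingValue_nonneg hV.nonneg (hI.pending (m + 1))
      rw [load, ceiling, if_pos hm] at h6
      have h8 : 1 ≤ transProb P.toEnvironment C h (m + 1) := by nlinarith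
      nlinarith [hlevel (m + 1) hm.le, w.cap_le (along V h m), hv (m + 1)]
  have h1 := hdesc (h.length - 1) (by omega) (by omega) hpath
  have h2 := hI.load_le w V hV h.length le_rfl
  obtain ⟨n, hn⟩ : ∃ n, h.length = n + 1 := ⟨h.length - 1, by omega⟩
  have h3 : pendingValue V (R h.length) = p * V x + pendingValue V rest := by
    rw [hR, pendingValue_cons]
  have h4 : 0 ≤ pendingValue V rest := pendingValue_nonneg hV.nonneg fun e he =>
    hI.pending h.length e (by rw [hR]; exact List.mem_cons_of_mem _ he)
  rw [load, h3, if_neg (lt_irrefl _)] at h2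
  have h5 := hlevel h.length le_rfl
  have h6 := hV.nonneg x
  have h7 : V x ≤ ceiling w V x₀ h h.length := by nlinarith
  rw [hn, ceiling] at h7
  rw [hn, Nat.add_sub_cancel, hvk] at h1
  -- This is the extreme case `l = 1`, where positivity of the slack alone decides.
  have h8 := w.noter_le_of_le_cap (t := along V h n) le_rfl (by linarith)
  linarith

end Updates

-- The AND-step and the OR-step preserve the invariant.

section Outcomes

variable {P : PlanningProblem S A O} {σ : SearchOrder P.toEnvironment Q} {C : FSC Q O A} {q : Q}
  {s : S} {h : List (Q × S)}

/-- The outcomes `outs` with controller state `q` are possible continuations of `h`. -/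
def Continues (P : PlanningProblem S A O) (C : FSC Q O A) (q : Q) (outs : List (S × ℝ)) (h : List (Q × S)) : Prop :=
  ∀ o ∈ outs, 0 < o.2 ∧ transProb P.toEnvironment C (h ++ [(q, o.1)]) h.length = o.2

theorem Continues.extends {outs : List (S × ℝ)} (hc : Continues P C q outs h) {C' : FSC Q O A}
    (hC : C'.Extends C) (hacts : ∀ x ∈ h, C.Acts P.toEnvironment x) :
    Continues P C' q outs h := fun o ho => by
  rw [transProb_extends hC (by simpa using hacts)]
  exact hc o ho

/-- The list of pending outcomes that belongs to the argument `outs` of an AND-step in the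
controller state `q`. -/
def withState (q : Q) (outs : List (S × ℝ)) : List ((Q × S) × ℝ) :=
  outs.map fun o => ((q, o.1), o.2)

theorem continues_outcomes {a : A} {q' : Q} (hγ : C.γ q (P.Ω s) = some (.act a))
    (hδ : C.δ q (P.Ω s) = some q') :
    Continues P C q' ((σ.outcomes C h (q, s) a).map fun s' => (s', (P.Δ s a s').toReal))
      (h ++ [(q, s)]) := by
  intro o ho
  obtain ⟨s', hs', rfl⟩ := List.mem_map.mp ho
  have hpos := (σ.mem_outcomes C h (q, s) a s').mp hs'
  refine ⟨ENNReal.toReal_pos hpos.ne' (PMF.apply_ne_top _ _), ?_⟩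
  rw [List.length_append, List.length_singleton,
    transProb_succ (x := (q, s)) (y := (q', s')) (by simp) (by simp),
    FSC.stepProb_of_act hγ hδ, if_pos rfl]

theorem pendingValue_outcomes [Fintype S] (V : Q × S → ℝ) (a : A) (q' : Q) :
    pendingValue V (withState q'
      ((σ.outcomes C h (q, s) a).map fun s' => (s', (P.Δ s a s').toReal))) =
      ∑ s', (P.Δ s a s').toReal * V (q', s') := by
  classical
  unfold pendingValue withState
  rw [List.map_map, List.map_map, ← List.sum_toFinset _ (σ.nodup_outcomes C h (q, s) a)]
  -- The enumeration omits only states of probability zero.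
  refine Finset.sum_subset (Finset.subset_univ _) fun s' _ hs' => ?_
  have hzero : P.Δ s a s' = 0 := by
    by_contra hne
    exact hs' (List.mem_toFinset.mpr ((σ.mem_outcomes C h (q, s) a s').mpr (pos_iff_ne_zero.mpr hne)))
  simp [hzero]

end Outcomes

section Spec

variable [Fintype Q] [Fintype S] (P : PlanningProblem S A O)
  (σ : SearchOrder P.toEnvironment Q) (LTERstar LGTstar : ℝ)

open Classical in
/-- The part of an OR-step after the transition `⟨l, q'⟩` of the combined state `⟨q, s⟩` has been
looked up or chosen. -/
def follow (C : FSC Q O A) (l : Label A) (q' : Q) (q : Q) (s : S) (p : ℝ) (h : List (Q × S))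
    (α : Alpha) : List (FSC Q O A × Alpha) :=
  match l with
  | .halt => [(C, if s ∈ P.G then α.addGoal h.length p else α.addFail h.length p)]
  | .act a => andStep P σ LTERstar LGTstar C q'
      ((σ.outcomes C h (q, s) a).map fun s' => (s', (P.Δ s a s').toReal))
      (h ++ [(q, s)]) (α.grow h.length)

variable {P σ LTERstar LGTstar} {C : FSC Q O A} {q : Q} {s : S} {p : ℝ} {h : List (Q × S)}
  {α : Alpha}

open Classical in
theorem orStep_of_mem (hmem : (q, s) ∈ h) :
    orStep P σ LTERstar LGTstar C q s p h α =
      if (C.likelihood P.toEnvironment (h.drop (h.idxOf (q, s)))).toReal * p < 1 then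
        [(C, α.addLoop (h.idxOf (q, s)) (h.length - 1)
          ((C.likelihood P.toEnvironment (h.drop (h.idxOf (q, s)))).toReal * p))]
      else [(C, α.addNoter h.length p)] := by
  rw [orStep, dif_pos hmem]

theorem orStep_of_defined (hmem : (q, s) ∉ h) {l : Label A} {q' : Q}
    (hγ : C.γ q (P.Ω s) = some l) (hδ : C.δ q (P.Ω s) = some q') :
    orStep P σ LTERstar LGTstar C q s p h α =
      follow P σ LTERstar LGTstar C l q' q s p h α := by
  rw [orStep, dif_neg hmem]
  simp only [hγ, hδ, List.flatMap_singleton]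
  cases l <;> rfl

theorem mem_orStep_of_not_defined (hmem : (q, s) ∉ h)
    (hdef : ∀ l q', C.γ q (P.Ω s) = some l → C.δ q (P.Ω s) ≠ some q')
    {r : FSC Q O A × Alpha} :
    r ∈ orStep P σ LTERstar LGTstar C q s p h α ↔
      ∃ l q', r ∈ follow P σ LTERstar LGTstar (C.extend q (P.Ω s) l q') l q' q s p h α := by
  rw [orStep, dif_neg hmem]
  simp only [List.mem_flatMap, List.mem_map]
  constructor
  · rintro ⟨_, ⟨⟨l, q'⟩, -, rfl⟩, hr⟩
    refine ⟨l, q', ?_⟩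
    cases l <;> exact hr
  · rintro ⟨l, q', hr⟩
    refine ⟨_, ⟨(l, q'), σ.mem_choices _ _ _ _, rfl⟩, ?_⟩
    cases l <;> exact hr

theorem exists_follow_of_mem_orStep (hmem : (q, s) ∉ h) {r : FSC Q O A × Alpha}
    (hr : r ∈ orStep P σ LTERstar LGTstar C q s p h α) :
    ∃ C' l q', C'.Extends C ∧ C'.γ q (P.Ω s) = some l ∧ C'.δ q (P.Ω s) = some q' ∧
      r ∈ follow P σ LTERstar LGTstar C' l q' q s p h α := by
  by_cases hdef : ∃ l q', C.γ q (P.Ω s) = some l ∧ C.δ q (P.Ω s) = some q'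
  · obtain ⟨l, q', hγ, hδ⟩ := hdef
    rw [orStep_of_defined hmem hγ hδ] at hr
    exact ⟨C, l, q', .refl C, hγ, hδ, hr⟩
  · have hdef' : ∀ l q', C.γ q (P.Ω s) = some l → C.δ q (P.Ω s) ≠ some q' :=
      fun l q' h1 h2 => hdef ⟨l, q', h1, h2⟩
    obtain ⟨l, q', hr⟩ := (mem_orStep_of_not_defined hmem hdef').mp hr
    exact ⟨_, l, q', C.extends_extend l q' hdef', C.extend_γ _ _ _ _, C.extend_δ _ _ _ _, hr⟩

/-- At a choice point the alternative prescribed by `D` is taken, so the enlarged controller is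
still extended by `D`. -/
theorem exists_follow_subset_orStep (hmem : (q, s) ∉ h) {D : FSC Q O A} (hD : D.Extends C)
    (hdefD : ∃ l q', D.γ q (P.Ω s) = some l ∧ D.δ q (P.Ω s) = some q') :
    ∃ C' l q', C'.Extends C ∧ D.Extends C' ∧ C'.γ q (P.Ω s) = some l ∧
      C'.δ q (P.Ω s) = some q' ∧ ∀ r ∈ follow P σ LTERstar LGTstar C' l q' q s p h α,
        r ∈ orStep P σ LTERstar LGTstar C q s p h α := by
  by_cases hdef : ∃ l q', C.γ q (P.Ω s) = some l ∧ C.δ q (P.Ω s) = some q'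
  · obtain ⟨l, q', hγ, hδ⟩ := hdef
    rw [orStep_of_defined hmem hγ hδ]
    exact ⟨C, l, q', .refl C, hD, hγ, hδ, fun _ hr => hr⟩
  · have hdef' : ∀ l q', C.γ q (P.Ω s) = some l → C.δ q (P.Ω s) ≠ some q' :=
      fun l q' h1 h2 => hdef ⟨l, q', h1, h2⟩
    obtain ⟨l, q', h1, h2⟩ := hdefD
    exact ⟨_, l, q', C.extends_extend l q' hdef', hD.extend h1 h2, C.extend_γ _ _ _ _,
      C.extend_δ _ _ _ _, fun r hr => (mem_orStep_of_not_defined hmem hdef').mpr ⟨l, q', hr⟩⟩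

variable {x₀ : Q × S}

variable (P σ LTERstar LGTstar x₀) in
/-- The AND-step preserves the invariant, and accounts for all likelihoods unless it succeeds. -/
def AndStepSpec (C : FSC Q O A) (q : Q) (outs : List (S × ℝ)) (h : List (Q × S)) (α : Alpha) :
    Prop :=
  ∀ R : ℕ → List ((Q × S) × ℝ), R h.length = withState q outs → Invariant P x₀ C h α R →
    Exhaustive P C h α R → Continues P C q outs h →
    ∀ r ∈ andStep P σ LTERstar LGTstar C q outs h α, r.1.Extends C ∧
      Invariant P x₀ r.1 h.dropLast r.2 (Function.update R h.length []) ∧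
      (Exhaustive P r.1 h.dropLast r.2 (Function.update R h.length []) ∨
        Success P.toEnvironment LTERstar LGTstar r.1 h.dropLast r.2)

variable (P σ LTERstar LGTstar x₀) in
/-- The OR-step preserves the invariant, and accounts for all likelihoods unless it succeeds. -/
def OrStepSpec (C : FSC Q O A) (q : Q) (s : S) (p : ℝ) (h : List (Q × S)) (α : Alpha) : Prop :=
  ∀ (R : ℕ → List ((Q × S) × ℝ)) (rest : List ((Q × S) × ℝ)),
    R h.length = ((q, s), p) :: rest → Invariant P x₀ C h α R →
    Exhaustive P C h α R → 0 < p →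
    transProb P.toEnvironment C (h ++ [(q, s)]) h.length = p →
    ∀ r ∈ orStep P σ LTERstar LGTstar C q s p h α, r.1.Extends C ∧
      Invariant P x₀ r.1 h r.2 (Function.update R h.length rest) ∧
      (Exhaustive P r.1 h r.2 (Function.update R h.length rest) ∨
        Success P.toEnvironment LTERstar LGTstar r.1 h r.2)

theorem orStepSpec_of_mem (hmem : (q, s) ∈ h) :
    OrStepSpec P σ LTERstar LGTstar x₀ C q s p h α := by
  classical
  intro R rest hR hI hE hp hx r hr
  rw [orStep_of_mem hmem] at hr
  have hk : h.idxOf (q, s) < h.length := List.idxOf_lt_length_iff.mpr hmem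
  have hget : h[h.idxOf (q, s)]? = some (q, s) := by
    rw [List.getElem?_eq_getElem hk, List.getElem_idxOf hk]
  generalize h.idxOf (q, s) = k at *
  have hvk : ∀ V : Q × S → ℝ, along V h k = V (q, s) := fun V => by simp [along, hget]
  rw [likelihood_drop_toReal hk] at hr
  have hpath : 0 < pathProb (transProb P.toEnvironment C h) k (h.length - 1) :=
    pathProb_pos fun i hi => hI.pos i (by omega)
  have hp1 : p ≤ 1 := hx ▸ transProb_le_one _
  split_ifs at hr with hlt
  · obtain rfl := List.mem_singleton.mp hr
    refine ⟨.refl C, hI.settle hR (hI.nonneg.addLoop (mul_pos hpath hp).le)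
      (fun _ V => p * V (q, s)) (fun w V j => ?_) (fun _ _ _ => le_rfl),
      .inl (hE.settle hR fun j => ?_)⟩
    -- The path likelihood cancels, and the return is valued at exactly `p * V (q, s)`.
    · rw [Alpha.level_addLoop hk, mul_div_cancel_left₀ _ hpath.ne', hvk]
    · rw [Alpha.level_addLoop hk, mul_div_cancel_left₀ _ hpath.ne', hvk, mul_one]
  · obtain rfl := List.mem_singleton.mp hr
    have hpath1 : pathProb (transProb P.toEnvironment C h) k (h.length - 1) ≤ 1 :=
      Finset.prod_le_one (fun i _ => transProb_nonneg i) fun i _ => transProb_le_one i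
    refine ⟨.refl C, hI.settle hR (hI.nonneg.addNoter hp.le)
      (fun w _ => w.noter * p) (fun w V j => Alpha.level_addNoter p) (fun w V hV => ?_),
      .inl (hE.settle hR fun j => ?_)⟩
    · rw [mul_comm]
      exact mul_le_mul_of_nonneg_left
        (hI.noter_le_of_cycle hR hget (by nlinarith) (by nlinarith) hV) hp.le
    · rw [Alpha.level_addNoter, show Weights.one.noter = 1 from rfl, one_mul]

theorem orStepSpec_of_not_mem (hmem : (q, s) ∉ h)
    (ih : ∀ C q' outs α, AndStepSpec P σ LTERstar LGTstar x₀ C q' outs (h ++ [(q, s)]) α) :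
    OrStepSpec P σ LTERstar LGTstar x₀ C q s p h α := by
  intro R rest hR hI hE hp hx r hr
  obtain ⟨C', l, q', hC, hγ, hδ, hr⟩ := exists_follow_of_mem_orStep hmem hr
  have hI' := hI.extends hC
  have hE' := hE.extends hC hI.acts
  have hx' : transProb P.toEnvironment C' (h ++ [(q, s)]) h.length = p := by
    rw [transProb_extends hC (by simpa using hI.acts), hx]
  cases l with
  | halt =>
    simp only [follow] at hr
    obtain rfl := List.mem_singleton.mp hr
    refine ⟨hC, ?_⟩
    by_cases hs : s ∈ P.G
    · simp only [if_pos hs]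
      refine ⟨hI'.settle hR (hI.nonneg.addGoal hp.le)
        (fun w _ => w.goal * p) (fun w V j => Alpha.level_addGoal p) (fun w V hV => ?_),
        .inl (hE'.settle hR fun j => ?_)⟩
      · rw [mul_comm]
        exact mul_le_mul_of_nonneg_left (hV.goal q s q' hγ hδ hs) hp.le
      · rw [Alpha.level_addGoal, show Weights.one.goal = 1 from rfl, one_mul]
    · simp only [if_neg hs]
      refine ⟨hI'.settle hR (hI.nonneg.addFail hp.le)
        (fun w _ => w.fail * p) (fun w V j => Alpha.level_addFail p) (fun w V hV => ?_),
        .inl (hE'.settle hR fun j => ?_)⟩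
      · rw [mul_comm]
        exact mul_le_mul_of_nonneg_left (hV.fail q s q' hγ hδ hs) hp.le
      · rw [Alpha.level_addFail, show Weights.one.fail = 1 from rfl, one_mul]
  | act a =>
    simp only [follow] at hr
    have hc := continues_outcomes (σ := σ) (h := h) hγ hδ
    have houts : ∀ e ∈ withState q'
        ((σ.outcomes C' h (q, s) a).map fun s' => (s', (P.Δ s a s').toReal)), 0 ≤ e.2 := by
      intro e he
      obtain ⟨o, ho, rfl⟩ := List.mem_map.mp he
      exact (hc o ho).1.le
    have hI'' := hI'.push hR hp hx' ⟨a, q', hγ, hδ⟩ houts fun w V hV => by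
      rw [pendingValue_outcomes]
      exact hV.act q s a q' hγ hδ
    have hE'' := hE'.push hR hx' (outs := withState q'
        ((σ.outcomes C' h (q, s) a).map fun s' => (s', (P.Δ s a s').toReal))) (by
      rw [pendingValue_outcomes]
      simp [sum_toReal_pmf])
    obtain ⟨h1, h2, h3⟩ := ih _ _ _ _ _ (by simp) hI'' hE'' hc r hr
    rw [List.dropLast_concat] at h2 h3
    have hcongr : ∀ j ≤ h.length, Function.update (Function.update (Function.update R h.length rest)
        (h.length + 1) (withState q'
          ((σ.outcomes C' h (q, s) a).map fun s' => (s', (P.Δ s a s').toReal))))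
        (h ++ [(q, s)]).length [] j = Function.update R h.length rest j := fun j hj => by
      rw [List.length_append, List.length_singleton, Function.update_of_ne (by omega),
        Function.update_of_ne (by omega)]
    have hpend : ∀ j, ∀ e ∈ Function.update R h.length rest j, 0 ≤ e.2 := by
      intro j e he
      rcases eq_or_ne j h.length with rfl | hj
      · rw [Function.update_self] at he
        exact hI.pending h.length e (by rw [hR]; exact List.mem_cons_of_mem _ he)
      · rw [Function.update_of_ne hj] at he
        exact hI.pending j e he
    exact ⟨h1.comp hC, h2.congr_pending hcongr hpend,
      h3.imp_left fun h3 => h3.congr_pending hcongr⟩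

open Classical in
theorem andStep_cons (rest : List (S × ℝ)) :
    andStep P σ LTERstar LGTstar C q ((s, p) :: rest) h α =
      (orStep P σ LTERstar LGTstar C q s p h α).flatMap fun r =>
        if Success P.toEnvironment LTERstar LGTstar r.1 h r.2 then
          [(r.1, cumulateAlpha P.toEnvironment r.1 h r.2)]
        else if 1 - (calcLambda P.toEnvironment r.1 h r.2).fail -
              (calcLambda P.toEnvironment r.1 h r.2).noter < LGTstar ∨
            1 - (calcLambda P.toEnvironment r.1 h r.2).noter < LTERstar then
          []
        else andStep P σ LTERstar LGTstar r.1 q rest h r.2 := by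
  rw [andStep]
  congr 1
  funext r
  simp only [Success]
  congr

/-- An OR-step that loses exhaustiveness must have met the success condition, which is tested
immediately afterwards. So the loop over the outcomes only continues with exhaustive data, and a
success found at depth stops every enclosing AND-step. -/
theorem andStepSpec_of_orStepSpec
    (hor : ∀ C s p α, OrStepSpec P σ LTERstar LGTstar x₀ C q s p h α) (outs : List (S × ℝ)) :
    ∀ C α, AndStepSpec P σ LTERstar LGTstar x₀ C q outs h α := by
  classical
  induction outs with
  | nil =>
    intro C α R hR hI hE _ r hr
    rw [andStep] at hr
    obtain rfl := List.mem_singleton.mp hr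
    have hR' : R h.length = [] := hR
    rw [← hR', Function.update_eq_self]
    exact ⟨.refl C, hI.cumulateAlpha, .inl (hE.cumulateAlpha hI hR')⟩
  | cons o rest ih =>
    obtain ⟨s, p⟩ := o
    intro C α R hR hI hE hc r hr
    rw [andStep_cons, List.mem_flatMap] at hr
    obtain ⟨r', hr', hr⟩ := hr
    obtain ⟨hp, hx⟩ := hc _ List.mem_cons_self
    obtain ⟨h1, h2, h3⟩ := hor C s p α R (withState q rest) hR hI hE hp hx r' hr'
    split_ifs at hr with hs hf
    · obtain rfl := List.mem_singleton.mp hr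
      -- The early return discards pending outcomes. Their value is nonnegative, so the upper bounds
      -- persist, although exhaustiveness may fail.
      have h4 : Invariant P x₀ r'.1 h r'.2 (Function.update R h.length []) := by
        refine ⟨h2.nonneg, h2.pos, h2.acts, fun j e he => ?_, fun w V hV j hj => ?_⟩
        · rcases eq_or_ne j h.length with rfl | hj
          · simp at he
          · rw [Function.update_of_ne hj] at he
            exact hI.pending j e he
        · refine le_trans ?_ (h2.load_le w V hV j hj)
          rcases eq_or_ne j h.length with rfl | hj
          · have h5 := pendingValue_nonneg hV.nonneg (h2.pending h.length)
            rw [load, load, Function.update_self, pendingValue_nil]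
            linarith
          · exact (load_congr_pending (by
              rw [Function.update_of_ne hj, Function.update_of_ne hj])).le
      exact ⟨h1, h4.cumulateAlpha, .inr hs.cumulateAlpha⟩
    · simp at hr
    · have hc' : Continues P r'.1 q rest h := Continues.extends
        (fun o ho => hc o (List.mem_cons_of_mem _ ho)) h1 hI.acts
      obtain ⟨h5, h6, h7⟩ := ih r'.1 r'.2 _ (Function.update_self _ _ _) h2
        (h3.resolve_right hs) hc' r hr
      rw [Function.update_idem] at h6 h7
      exact ⟨h5.comp h1, h6, h7⟩

theorem andStepSpec (h : List (Q × S)) : ∀ C q outs α,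
    AndStepSpec P σ LTERstar LGTstar x₀ C q outs h α := by
  induction hm : unvisited h using Nat.strong_induction_on generalizing h with
  | _ m ih =>
    intro C q outs
    refine fun α => andStepSpec_of_orStepSpec (fun C s p α => ?_) outs C α
    by_cases hmem : (q, s) ∈ h
    · exact orStepSpec_of_mem hmem
    -- The recursion goes deeper only at combined states not yet on the history, as in the
    -- termination proof of the search.
    · exact orStepSpec_of_not_mem hmem (ih _ (hm ▸ unvisited_append_lt hmem) _ rfl)

theorem orStepSpec (C : FSC Q O A) (q : Q) (s : S) (p : ℝ) (h : List (Q × S)) (α : Alpha) :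
    OrStepSpec P σ LTERstar LGTstar x₀ C q s p h α := by
  by_cases hmem : (q, s) ∈ h
  · exact orStepSpec_of_mem hmem
  · exact orStepSpec_of_not_mem hmem (andStepSpec _)

-- The branch dictated by a viable controller survives.

section Completeness

variable (P LTERstar LGTstar x₀) in
/-- A controller that is never pruned: it is defined everywhere, and the values kept by the search
never refute a controller that it extends. -/
structure Viable (D : FSC Q O A) : Prop where
  total : ∀ q o, ∃ l q', D.γ q o = some l ∧ D.δ q o = some q'
  not_pruned : ∀ C h α R, D.Extends C → Invariant P x₀ C h α R →
    LGTstar ≤ 1 - (calcLambda P.toEnvironment C h α).fail -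
        (calcLambda P.toEnvironment C h α).noter ∧
      LTERstar ≤ 1 - (calcLambda P.toEnvironment C h α).noter

variable {D : FSC Q O A}

variable (P σ LTERstar LGTstar x₀ D) in
/-- The AND-step does not fail on controllers extended by `D`. -/
def AndStepComplete (C : FSC Q O A) (q : Q) (outs : List (S × ℝ)) (h : List (Q × S))
    (α : Alpha) : Prop :=
  ∀ R : ℕ → List ((Q × S) × ℝ), R h.length = withState q outs → Invariant P x₀ C h α R →
    Exhaustive P C h α R → Continues P C q outs h → D.Extends C →
    ∃ r ∈ andStep P σ LTERstar LGTstar C q outs h α, D.Extends r.1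

variable (P σ LTERstar LGTstar x₀ D) in
/-- The OR-step does not fail on controllers extended by `D`. -/
def OrStepComplete (C : FSC Q O A) (q : Q) (s : S) (p : ℝ) (h : List (Q × S)) (α : Alpha) : Prop :=
  ∀ (R : ℕ → List ((Q × S) × ℝ)) (rest : List ((Q × S) × ℝ)),
    R h.length = ((q, s), p) :: rest → Invariant P x₀ C h α R →
    Exhaustive P C h α R → 0 < p →
    transProb P.toEnvironment C (h ++ [(q, s)]) h.length = p → D.Extends C →
    ∃ r ∈ orStep P σ LTERstar LGTstar C q s p h α, D.Extends r.1

theorem orStepComplete_of_mem (hmem : (q, s) ∈ h) :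
    OrStepComplete P σ LTERstar LGTstar x₀ D C q s p h α := by
  intro R rest _ _ _ _ _ hD
  rw [orStep_of_mem hmem]
  split_ifs
  exacts [⟨_, List.mem_singleton_self _, hD⟩, ⟨_, List.mem_singleton_self _, hD⟩]

theorem orStepComplete_of_not_mem (hV : Viable P LTERstar LGTstar x₀ D) (hmem : (q, s) ∉ h)
    (ih : ∀ C q' outs α,
      AndStepComplete P σ LTERstar LGTstar x₀ D C q' outs (h ++ [(q, s)]) α) :
    OrStepComplete P σ LTERstar LGTstar x₀ D C q s p h α := by
  intro R rest hR hI hE hp hx hD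
  obtain ⟨C', l, q', hC, hD', hγ, hδ, hsub⟩ := exists_follow_subset_orStep (P := P) (σ := σ)
    (LTERstar := LTERstar) (LGTstar := LGTstar) (p := p) (α := α) hmem hD (hV.total q (P.Ω s))
  suffices hex : ∃ r ∈ follow P σ LTERstar LGTstar C' l q' q s p h α, D.Extends r.1 by
    obtain ⟨r, hr, hDr⟩ := hex
    exact ⟨r, hsub r hr, hDr⟩
  cases l with
  | halt => exact ⟨_, List.mem_singleton_self _, hD'⟩
  | act a =>
    have hx' : transProb P.toEnvironment C' (h ++ [(q, s)]) h.length = p := by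
      rw [transProb_extends hC (by simpa using hI.acts), hx]
    have hc := continues_outcomes (σ := σ) (h := h) hγ hδ
    have houts : ∀ e ∈ withState q'
        ((σ.outcomes C' h (q, s) a).map fun s' => (s', (P.Δ s a s').toReal)), 0 ≤ e.2 := by
      intro e he
      obtain ⟨o, ho, rfl⟩ := List.mem_map.mp he
      exact (hc o ho).1.le
    have hI'' := (hI.extends hC).push hR hp hx' ⟨a, q', hγ, hδ⟩ houts fun w V hV => by
      rw [pendingValue_outcomes]
      exact hV.act q s a q' hγ hδ
    have hE'' := (hE.extends hC hI.acts).push hR hx' (outs := withState q'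
        ((σ.outcomes C' h (q, s) a).map fun s' => (s', (P.Δ s a s').toReal))) (by
      rw [pendingValue_outcomes]
      simp [sum_toReal_pmf])
    exact ih _ _ _ _ _ (by simp) hI'' hE'' hc hD'

theorem andStepComplete_of_orStepComplete (hV : Viable P LTERstar LGTstar x₀ D)
    (hor : ∀ C s p α, OrStepComplete P σ LTERstar LGTstar x₀ D C q s p h α)
    (outs : List (S × ℝ)) :
    ∀ C α, AndStepComplete P σ LTERstar LGTstar x₀ D C q outs h α := by
  classical
  induction outs with
  | nil =>
    intro C α R _ _ _ _ hD
    rw [andStep]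
    exact ⟨_, List.mem_singleton_self _, hD⟩
  | cons o rest ih =>
    obtain ⟨s, p⟩ := o
    intro C α R hR hI hE hc hD
    obtain ⟨hp, hx⟩ := hc _ List.mem_cons_self
    obtain ⟨r, hr, hDr⟩ := hor C s p α R (withState q rest) hR hI hE hp hx hD
    -- The soundness specification supplies the invariant that rules out pruning, and exhaustiveness
    -- for the outcomes that follow.
    obtain ⟨h1, h2, h3⟩ := orStepSpec (x₀ := x₀) C q s p h α R (withState q rest) hR hI hE hp hx r hr
    rw [andStep_cons]
    suffices hex : ∃ r' ∈ (if Success P.toEnvironment LTERstar LGTstar r.1 h r.2 then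
          [(r.1, cumulateAlpha P.toEnvironment r.1 h r.2)]
        else if 1 - (calcLambda P.toEnvironment r.1 h r.2).fail -
              (calcLambda P.toEnvironment r.1 h r.2).noter < LGTstar ∨
            1 - (calcLambda P.toEnvironment r.1 h r.2).noter < LTERstar then
          []
        else andStep P σ LTERstar LGTstar r.1 q rest h r.2), D.Extends r'.1 by
      obtain ⟨r', hr', hD'⟩ := hex
      exact ⟨r', List.mem_flatMap.mpr ⟨r, hr, hr'⟩, hD'⟩
    obtain ⟨h4, h5⟩ := hV.not_pruned _ _ _ _ hDr h2
    split_ifs with hs hf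
    · exact ⟨_, List.mem_singleton_self _, hDr⟩
    · rcases hf with hf | hf
      · exact absurd h4 (not_le.mpr hf)
      · exact absurd h5 (not_le.mpr hf)
    · exact ih r.1 r.2 _ (Function.update_self _ _ _) h2 (h3.resolve_right hs)
        (Continues.extends (fun o ho => hc o (List.mem_cons_of_mem _ ho)) h1 hI.acts) hDr

theorem andStepComplete (hV : Viable P LTERstar LGTstar x₀ D) (h : List (Q × S)) :
    ∀ C q outs α, AndStepComplete P σ LTERstar LGTstar x₀ D C q outs h α := by
  induction hm : unvisited h using Nat.strong_induction_on generalizing h with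
  | _ m ih =>
    intro C q outs
    refine fun α => andStepComplete_of_orStepComplete hV (fun C s p α => ?_) outs C α
    by_cases hmem : (q, s) ∈ h
    · exact orStepComplete_of_mem hmem
    · exact orStepComplete_of_not_mem hV hmem (ih _ (hm ▸ unvisited_append_lt hmem) _ rfl)

end Completeness

end Spec

end Pandor

-- Halting probabilities by number of steps.

namespace FSC

variable {Q S A O : Type*}

open Classical in
/-- The probability of halting in a state of `good` after exactly `n` steps. -/
def exitProb (C : FSC Q O A) (E : Environment S A O) (good : Set S) : ℕ → Q × S → ℝ≥0∞
  | 0, x => if C.γ x.1 (E.Ω x.2) = some .halt ∧ x.2 ∈ good then 1 else 0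
  | n + 1, x => ∑' y, C.stepProb E x y * exitProb C E good n y

/-- The last combined state of `h` is one where the controller halts in a state of `good`. -/
def EndsIn (C : FSC Q O A) (E : Environment S A O) (good : Set S) (h : List (Q × S)) : Prop :=
  ∃ x, h.getLast? = some x ∧ C.γ x.1 (E.Ω x.2) = some .halt ∧ x.2 ∈ good

open Classical in
/-- The likelihood of a sequence of combined states if it ends by halting in a state of `good`. -/
def exitLikelihood (C : FSC Q O A) (E : Environment S A O) (good : Set S) (h : List (Q × S)) :
    ℝ≥0∞ :=
  if C.EndsIn E good h then C.likelihood E h else 0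

section ExitProb

variable {C : FSC Q O A} {E : Environment S A O} {good : Set S}

theorem exitLikelihood_cons_cons (x y : Q × S) (t : List (Q × S)) :
    C.exitLikelihood E good (x :: y :: t) = C.stepProb E x y * C.exitLikelihood E good (y :: t) := by
  have h : C.EndsIn E good (x :: y :: t) ↔ C.EndsIn E good (y :: t) := by
    simp only [EndsIn, List.getLast?_cons_cons]
  unfold exitLikelihood
  by_cases h' : C.EndsIn E good (y :: t)
  · rw [if_pos h', if_pos (h.mpr h'), likelihood]
  · rw [if_neg h', if_neg (mt h.mp h'), mul_zero]

/-- A list of length `n + 1` is a head and a list of length `n`. -/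
def consEquiv (α : Type*) (n : ℕ) :
    α × {t : List α // t.length = n} ≃ {t : List α // t.length = n + 1} where
  toFun e := ⟨e.1 :: e.2.1, by simp [e.2.2]⟩
  invFun t := ⟨t.1.head (List.ne_nil_of_length_eq_add_one t.2), t.1.tail, by simp [t.2]⟩
  left_inv e := by simp
  right_inv t := by simp

theorem exitProb_eq_tsum (n : ℕ) (x : Q × S) :
    C.exitProb E good n x =
      ∑' t : {t : List (Q × S) // t.length = n}, C.exitLikelihood E good (x :: t.1) := by
  induction n generalizing x with
  | zero =>
    rw [tsum_eq_single (⟨[], rfl⟩ : {t : List (Q × S) // t.length = 0}) fun t ht =>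
      absurd (Subtype.ext (List.length_eq_zero_iff.mp t.2)) ht]
    have h : C.EndsIn E good [x] ↔ C.γ x.1 (E.Ω x.2) = some .halt ∧ x.2 ∈ good := by
      simp [EndsIn]
    unfold exitProb exitLikelihood
    by_cases h' : C.EndsIn E good [x]
    · rw [if_pos h', if_pos (h.mp h'), likelihood]
    · rw [if_neg h', if_neg (mt h.mpr h')]
  | succ n ih =>
    rw [← (consEquiv (Q × S) n).tsum_eq, ENNReal.tsum_prod', exitProb]
    refine tsum_congr fun y => ?_
    rw [ih, ← ENNReal.tsum_mul_left]
    exact tsum_congr fun t => (exitLikelihood_cons_cons x y t.1).symm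

theorem isChain_of_likelihood_ne_zero : ∀ {h : List (Q × S)}, C.likelihood E h ≠ 0 →
    h.IsChain fun x y => 0 < C.stepProb E x y
  | [], _ => .nil
  | [_], _ => .singleton _
  | x :: y :: t, hne => by
    rw [likelihood] at hne
    exact .cons_cons (pos_iff_ne_zero.mpr (left_ne_zero_of_mul hne))
      (isChain_of_likelihood_ne_zero (right_ne_zero_of_mul hne))

/-- Histories are grouped by length. Lists from the initial state that are not chains have
likelihood zero, so they may be included in the sum. -/
theorem tsum_likelihood_eq (C : FSC Q O A) (P : PlanningProblem S A O) (good : Set S) :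
    ∑' h : {h : List (Q × S) // C.IsHistory P h ∧ C.EndsIn P.toEnvironment good h},
      C.likelihood P.toEnvironment h.1 =
      ∑' n, C.exitProb P.toEnvironment good n (C.q₀, P.s₀) := by
  classical
  have h1 : ∀ t : List (Q × S),
      ({h | C.IsHistory P h ∧ C.EndsIn P.toEnvironment good h}.indicator
        (C.likelihood P.toEnvironment)) ((C.q₀, P.s₀) :: t) =
        C.exitLikelihood P.toEnvironment good ((C.q₀, P.s₀) :: t) := by
    intro t
    rw [Set.indicator_apply, exitLikelihood]
    by_cases h2 : C.EndsIn P.toEnvironment good ((C.q₀, P.s₀) :: t)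
    · by_cases h3 : C.likelihood P.toEnvironment ((C.q₀, P.s₀) :: t) = 0
      · simp [h3]
      · rw [if_pos h2, if_pos ⟨⟨rfl, isChain_of_likelihood_ne_zero h3⟩, h2⟩]
    · rw [if_neg h2, if_neg fun h3 => h2 h3.2]
  refine (tsum_subtype {h | C.IsHistory P h ∧ C.EndsIn P.toEnvironment good h}
    (C.likelihood P.toEnvironment)).trans ?_
  rw [← (List.cons_injective (a := (C.q₀, P.s₀))).tsum_eq, tsum_congr h1,
    ← (Equiv.sigmaFiberEquiv (List.length (α := Q × S))).tsum_eq, ENNReal.tsum_sigma']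
  · exact tsum_congr fun n => (exitProb_eq_tsum n _).symm
  · intro h hh
    obtain ⟨⟨hhead, -⟩, -⟩ := Set.mem_of_indicator_ne_zero hh
    cases h with
    | nil => simp at hhead
    | cons x t =>
      obtain rfl : x = (C.q₀, P.s₀) := by simpa using hhead
      exact ⟨t, rfl⟩

theorem LTER_eq (C : FSC Q O A) (P : PlanningProblem S A O) :
    C.LTER P = ∑' n, C.exitProb P.toEnvironment Set.univ n (C.q₀, P.s₀) := by
  rw [← tsum_likelihood_eq, LTER]
  have h : C.IsTerminating P =
      fun h => C.IsHistory P h ∧ C.EndsIn P.toEnvironment Set.univ h := by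
    funext h
    simp [IsTerminating, EndsIn]
  rw [h]

theorem LGT_eq (C : FSC Q O A) (P : PlanningProblem S A O) :
    C.LGT P = ∑' n, C.exitProb P.toEnvironment P.G n (C.q₀, P.s₀) := by
  rw [← tsum_likelihood_eq, LGT]
  have h : C.IsGoal P = fun h => C.IsHistory P h ∧ C.EndsIn P.toEnvironment P.G h := by
    funext h
    simp only [IsGoal, IsTerminating, EndsIn, eq_iff_iff]
    constructor
    · rintro ⟨⟨h1, x, h2, h3⟩, y, h4, h5⟩
      obtain rfl : x = y := Option.some.inj (h2.symm.trans h4)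
      exact ⟨h1, x, h2, h3, h5⟩
    · rintro ⟨h1, x, h2, h3, h4⟩
      exact ⟨⟨h1, x, h2, h3⟩, x, h2, h4⟩
  rw [h]

theorem exitProb_succ_of_act {q : Q} {s : S} {a : A} {q' : Q}
    (hγ : C.γ q (E.Ω s) = some (.act a)) (hδ : C.δ q (E.Ω s) = some q') (n : ℕ) :
    C.exitProb E good (n + 1) (q, s) = ∑' s', E.Δ s a s' * C.exitProb E good n (q', s') := by
  classical
  rw [exitProb, ENNReal.tsum_prod', tsum_eq_single q']
  · exact tsum_congr fun s' => by rw [stepProb_of_act hγ hδ, if_pos rfl]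
  · intro r hr
    simp [stepProb_of_act (x := (q, s)) hγ hδ, hr]

theorem exitProb_succ_of_not_acts {x : Q × S} (h : ¬ C.Acts E x) (n : ℕ) :
    C.exitProb E good (n + 1) x = 0 := by
  simp [exitProb, stepProb_of_not_acts h]

theorem exitProb_zero_of_act {q : Q} {s : S} {a : A}
    (hγ : C.γ q (E.Ω s) = some (.act a)) : C.exitProb E good 0 (q, s) = 0 := by
  simp [exitProb, hγ]

theorem exitProb_zero_of_halt {q : Q} {s : S} (hγ : C.γ q (E.Ω s) = some .halt) :
    C.exitProb E good 0 (q, s) = good.indicator 1 s := by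
  classical
  simp [exitProb, hγ, Set.indicator_apply]

theorem exitProb_zero_le_one (x : Q × S) : C.exitProb E good 0 x ≤ 1 := by
  rw [exitProb]
  split_ifs
  exacts [le_rfl, zero_le_one]

/-- Halting and acting exclude each other at a combined state, so either only the term for zero
steps can be nonzero, or the sum is a mean over successors with one step fewer. -/
theorem sum_exitProb_le_one (M : ℕ) (x : Q × S) :
    ∑ n ∈ Finset.range M, C.exitProb E good n x ≤ 1 := by
  induction M generalizing x with
  | zero => simp
  | succ M ih =>
    rw [Finset.sum_range_succ']
    by_cases h : C.Acts E x
    · obtain ⟨q, s⟩ := x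
      obtain ⟨a, q', hγ, hδ⟩ := h
      rw [exitProb_zero_of_act hγ, add_zero]
      simp only [exitProb_succ_of_act hγ hδ]
      rw [← Summable.tsum_finsetSum fun _ _ => ENNReal.summable]
      simp only [← Finset.mul_sum]
      refine le_trans (ENNReal.tsum_le_tsum fun s' => mul_le_of_le_one_right' (ih (q', s'))) ?_
      exact (PMF.tsum_coe _).le
    · simp only [exitProb_succ_of_not_acts h]
      simpa using exitProb_zero_le_one x

theorem exitProb_le_one (n : ℕ) (x : Q × S) : C.exitProb E good n x ≤ 1 :=
  (Finset.single_le_sum (f := fun n => C.exitProb E good n x) (fun _ _ => zero_le)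
    (Finset.self_mem_range_succ n)).trans (sum_exitProb_le_one (n + 1) x)

theorem exitProb_ne_top (n : ℕ) (x : Q × S) : C.exitProb E good n x ≠ ∞ :=
  ne_top_of_le_ne_top ENNReal.one_ne_top (exitProb_le_one n x)

theorem tsum_exitProb_le_one (x : Q × S) : ∑' n, C.exitProb E good n x ≤ 1 :=
  ENNReal.tsum_le_of_sum_range_le fun M => sum_exitProb_le_one M x

theorem tsum_exitProb_of_act {q : Q} {s : S} {a : A} {q' : Q}
    (hγ : C.γ q (E.Ω s) = some (.act a)) (hδ : C.δ q (E.Ω s) = some q') :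
    ∑' n, C.exitProb E good n (q, s) = ∑' s', E.Δ s a s' * ∑' n, C.exitProb E good n (q', s') := by
  rw [tsum_eq_zero_add' ENNReal.summable, exitProb_zero_of_act hγ, zero_add]
  simp only [exitProb_succ_of_act hγ hδ, ← ENNReal.tsum_mul_left]
  exact ENNReal.tsum_comm

theorem exitProb_toReal_succ_of_act [Fintype S] {q : Q} {s : S} {a : A} {q' : Q}
    (hγ : C.γ q (E.Ω s) = some (.act a)) (hδ : C.δ q (E.Ω s) = some q') (n : ℕ) :
    (C.exitProb E good (n + 1) (q, s)).toReal =
      ∑ s', (E.Δ s a s').toReal * (C.exitProb E good n (q', s')).toReal := by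
  rw [exitProb_succ_of_act hγ hδ, tsum_fintype, ENNReal.toReal_sum fun s' _ =>
    ENNReal.mul_ne_top (PMF.apply_ne_top _ _) (exitProb_ne_top _ _)]
  simp only [ENNReal.toReal_mul]

end ExitProb

end FSC

-- Potentials built from halting probabilities.

namespace Pandor

open FSC

variable {Q S A O : Type*} {P : PlanningProblem S A O} {C : FSC Q O A} {good : Set S}

/-- Letting the number of steps tend to infinity and the discount factor to one. -/
theorem le_one_sub_of_discounted {x : Q × S} {c t : ℝ} (ht : 0 < t)
    (hle : ENNReal.ofReal t ≤ ∑' n, C.exitProb P.toEnvironment good n x)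
    (hc : ∀ β, 0 < β → β < 1 → ∀ M, c ≤ 1 -
      ∑ n ∈ Finset.range M, β ^ n * (C.exitProb P.toEnvironment good n x).toReal) :
    t ≤ 1 - c := by
  have h1 : ∀ M, ∑ n ∈ Finset.range M, (C.exitProb P.toEnvironment good n x).toReal ≤ 1 - c := by
    intro M
    -- The truncation at `M` leaves a polynomial in `β`, so the limit at one needs no exchange with
    -- an infinite sum.
    have hcont : Continuous fun β : ℝ =>
        ∑ n ∈ Finset.range M, β ^ n * (C.exitProb P.toEnvironment good n x).toReal := by fun_prop
    have hlim := (hcont.tendsto 1).mono_left (nhdsWithin_le_nhds (s := Set.Iio 1))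
    simp only [one_pow, one_mul] at hlim
    refine le_of_tendsto hlim ?_
    filter_upwards [Ioo_mem_nhdsLT (zero_lt_one (α := ℝ))] with β hβ
    linarith [hc β hβ.1 hβ.2 M]
  by_contra hlt
  have h2 : ∑' n, C.exitProb P.toEnvironment good n x ≤ ENNReal.ofReal (1 - c) := by
    refine ENNReal.tsum_le_of_sum_range_le fun M => ?_
    rw [← ENNReal.ofReal_toReal (ENNReal.sum_ne_top.mpr fun n _ => exitProb_ne_top n x),
      ENNReal.toReal_sum fun n _ => exitProb_ne_top n x]
    exact ENNReal.ofReal_le_ofReal (h1 M)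
  exact absurd (hle.trans h2)
    (not_le.mpr ((ENNReal.ofReal_lt_ofReal_iff ht).mpr (not_le.mp hlt)))

variable [Fintype S]

/-- The probability of halting in a state of `good` is an admissible potential. -/
theorem admissible_tsum_exitProb {w : Weights} (hw : w.noter = 0)
    (hgoal : ∀ s ∈ P.G, w.goal ≤ good.indicator 1 s)
    (hfail : ∀ s ∉ P.G, w.fail ≤ good.indicator 1 s) :
    Admissible P C w fun x => (∑' n, C.exitProb P.toEnvironment good n x).toReal := by
  classical
  have hne : ∀ x, ∑' n, C.exitProb P.toEnvironment good n x ≠ ∞ := fun x =>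
    ne_top_of_le_ne_top ENNReal.one_ne_top (tsum_exitProb_le_one x)
  have hhalt : ∀ q s, C.γ q (P.Ω s) = some .halt →
      good.indicator 1 s ≤ (∑' n, C.exitProb P.toEnvironment good n (q, s)).toReal := by
    intro q s hγ
    have h1 := ENNReal.le_tsum (f := fun n => C.exitProb P.toEnvironment good n (q, s)) 0
    rw [exitProb_zero_of_halt hγ] at h1
    have h2 := ENNReal.toReal_mono (hne (q, s)) h1
    refine le_trans ?_ h2
    simp only [Set.indicator_apply]
    split_ifs <;> simp
  refine ⟨fun x => ENNReal.toReal_nonneg, fun q s a q' hγ hδ => ?_,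
    fun q s q' hγ _ hs => (hgoal s hs).trans (hhalt q s hγ),
    fun q s q' hγ _ hs => (hfail s hs).trans (hhalt q s hγ)⟩
  have h1 : ∑ s', (P.Δ s a s').toReal *
        (∑' n, C.exitProb P.toEnvironment good n (q', s')).toReal =
      (∑' n, C.exitProb P.toEnvironment good n (q, s)).toReal := by
    rw [tsum_exitProb_of_act hγ hδ, tsum_fintype, ENNReal.toReal_sum fun s' _ =>
      ENNReal.mul_ne_top (PMF.apply_ne_top _ _) (hne _)]
    simp only [ENNReal.toReal_mul]
  rw [h1]
  have h2 : 0 ≤ (∑' n, C.exitProb P.toEnvironment good n (q, s)).toReal := ENNReal.toReal_nonneg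
  -- The potential is harmonic, and with weight zero for non-termination the second bound in `cap`
  -- is no stronger than the first.
  refine le_min le_rfl ?_
  rw [hw]
  nlinarith [w.slack_pos]

/-- The complement of the discounted probability of halting in a state of `good` within `M` steps
is an admissible potential. -/
theorem admissible_discounted {w : Weights} {β : ℝ} (hβ : 0 < β) (hβ1 : β < 1)
    (hslack : w.slack = (1 - β) / β) (hw : w.noter = 1)
    (hgoal : ∀ s ∈ P.G, w.goal ≤ 1 - good.indicator 1 s)
    (hfail : ∀ s ∉ P.G, w.fail ≤ 1 - good.indicator 1 s) (M : ℕ) :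
    Admissible P C w fun x => 1 -
      ∑ n ∈ Finset.range M, β ^ n * (C.exitProb P.toEnvironment good n x).toReal := by
  classical
  have hle : ∀ x, ∑ n ∈ Finset.range M,
      β ^ n * (C.exitProb P.toEnvironment good n x).toReal ≤ 1 := by
    intro x
    have h1 := ENNReal.toReal_mono ENNReal.one_ne_top
      (sum_exitProb_le_one (C := C) (E := P.toEnvironment) (good := good) M x)
    rw [ENNReal.toReal_sum fun n _ => exitProb_ne_top n x, ENNReal.toReal_one] at h1
    exact (Finset.sum_le_sum fun n _ => mul_le_of_le_one_left ENNReal.toReal_nonneg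
      (pow_le_one₀ hβ.le hβ1.le)).trans h1
  have hhalt : ∀ q s, C.γ q (P.Ω s) = some .halt →
      ∑ n ∈ Finset.range M, β ^ n * (C.exitProb P.toEnvironment good n (q, s)).toReal ≤
        good.indicator 1 s := by
    intro q s hγ
    have hnot : ¬ C.Acts P.toEnvironment (q, s) := by
      rintro ⟨a, q', h1, -⟩
      rw [hγ] at h1
      cases h1
    cases M with
    | zero =>
      simp only [Finset.range_zero, Finset.sum_empty, Set.indicator_apply]
      split_ifs <;> simp
    | succ M =>
      rw [Finset.sum_range_succ', Finset.sum_eq_zero fun n _ => by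
        rw [exitProb_succ_of_not_acts hnot, ENNReal.toReal_zero, mul_zero],
        exitProb_zero_of_halt hγ]
      simp only [Set.indicator_apply]
      split_ifs <;> simp
  refine ⟨fun x => sub_nonneg.mpr (hle x), fun q s a q' hγ hδ => ?_,
    fun q s q' hγ _ hs => (hgoal s hs).trans (by linarith [hhalt q s hγ]),
    fun q s q' hγ _ hs => (hfail s hs).trans (by linarith [hhalt q s hγ])⟩
  set T := ∑ n ∈ Finset.range M,
    β ^ n * (C.exitProb P.toEnvironment good (n + 1) (q, s)).toReal with hT
  have hT0 : 0 ≤ T := Finset.sum_nonneg fun n _ =>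
    mul_nonneg (pow_nonneg hβ.le n) ENNReal.toReal_nonneg
  have h1 : ∑ s', (P.Δ s a s').toReal * (1 - ∑ n ∈ Finset.range M,
      β ^ n * (C.exitProb P.toEnvironment good n (q', s')).toReal) = 1 - T := by
    simp only [mul_sub, mul_one, Finset.sum_sub_distrib, sum_toReal_pmf, Finset.mul_sum]
    rw [Finset.sum_comm, hT]
    congr 1
    refine Finset.sum_congr rfl fun n _ => ?_
    rw [exitProb_toReal_succ_of_act hγ hδ, Finset.mul_sum]
    exact Finset.sum_congr rfl fun _ _ => by ring
  -- One step shifts the index and costs a factor `β`; the truncated top term only helps.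
  have h2 : ∑ n ∈ Finset.range M, β ^ n * (C.exitProb P.toEnvironment good n (q, s)).toReal ≤
      β * T := by
    have h3 := Finset.sum_range_succ'
      (fun n => β ^ n * (C.exitProb P.toEnvironment good n (q, s)).toReal) M
    rw [Finset.sum_range_succ, exitProb_zero_of_act hγ, ENNReal.toReal_zero, mul_zero,
      add_zero] at h3
    have h4 : 0 ≤ β ^ M * (C.exitProb P.toEnvironment good M (q, s)).toReal :=
      mul_nonneg (pow_nonneg hβ.le M) ENNReal.toReal_nonneg
    have h5 : β * T = ∑ n ∈ Finset.range M,
        β ^ (n + 1) * (C.exitProb P.toEnvironment good (n + 1) (q, s)).toReal := by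
      rw [hT, Finset.mul_sum]
      exact Finset.sum_congr rfl fun _ _ => by ring
    linarith
  rw [h1]
  generalize ∑ n ∈ Finset.range M,
    β ^ n * (C.exitProb P.toEnvironment good n (q, s)).toReal = W at *
  refine le_min (by nlinarith) ?_
  -- The slack `(1 - β) / β` is the gain produced by discounting: it makes `1 + w.slack = β⁻¹`.
  have h6 : (1 + w.slack) * (1 - W) - w.slack * w.noter = 1 - W / β := by
    rw [hslack, hw]
    field_simp
    ring
  rw [h6]
  have h7 : W / β ≤ T := (div_le_iff₀ hβ).mpr (by linarith)
  linarith

/-- Weights one for goal and fail bound the termination value by `LTER`; weight one for goal alone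
bounds the goal value by `LGT`. -/
theorem Success.le {C : FSC Q O A} {LTERstar LGTstar : ℝ} {h : List (Q × S)} {α : Alpha}
    {R : ℕ → List ((Q × S) × ℝ)} (hI : Invariant P (C.q₀, P.s₀) C h α R)
    (hS : Success P.toEnvironment LTERstar LGTstar C h α) :
    ENNReal.ofReal LTERstar ≤ C.LTER P ∧ ENNReal.ofReal LGTstar ≤ C.LGT P := by
  classical
  constructor
  · rw [LTER_eq]
    refine ENNReal.ofReal_le_of_le_toReal (hS.2.trans ?_)
    have h1 := hI.calcLambda_le (admissible_tsum_exitProb (C := C) (P := P) (good := Set.univ)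
      (w := ⟨1, 1, 0, 1, zero_le_one, zero_le_one, le_rfl, one_pos⟩) rfl (by simp) (by simp))
    simpa using h1
  · rw [LGT_eq]
    refine ENNReal.ofReal_le_of_le_toReal (hS.1.trans ?_)
    have h1 := hI.calcLambda_le (admissible_tsum_exitProb (C := C) (P := P) (good := P.G)
      (w := ⟨1, 0, 0, 1, zero_le_one, le_rfl, le_rfl, one_pos⟩) rfl
      (fun s hs => by simp [hs]) (fun s hs => by simp [hs]))
    simpa using h1

/-- Here the weights count the outcomes that preclude the target: failure and non-termination for
goal termination, non-termination alone for termination. The potentials of `D` are admissible for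
every controller it extends. -/
theorem viable_of_le {D : FSC Q O A} {LTERstar LGTstar : ℝ} (hLTER : 0 < LTERstar)
    (hLGT : 0 < LGTstar) (htotal : ∀ q o, ∃ l q', D.γ q o = some l ∧ D.δ q o = some q')
    (h1 : ENNReal.ofReal LTERstar ≤ D.LTER P) (h2 : ENNReal.ofReal LGTstar ≤ D.LGT P) :
    Viable P LTERstar LGTstar (D.q₀, P.s₀) D := by
  classical
  refine ⟨htotal, fun C h α R hD hI => ⟨?_, ?_⟩⟩
  · rw [LGT_eq] at h2
    rw [sub_sub]
    refine le_one_sub_of_discounted hLGT h2 fun β hβ hβ1 M => ?_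
    have h3 := hI.calcLambda_le (.mono hD (admissible_discounted (C := D) (P := P) (good := P.G)
      (w := ⟨0, 1, 1, (1 - β) / β, le_rfl, zero_le_one, zero_le_one,
        div_pos (by linarith) hβ⟩) hβ hβ1 rfl rfl
      (fun s hs => by simp [hs]) (fun s hs => by simp [hs]) M))
    simpa using h3
  · rw [LTER_eq] at h1
    refine le_one_sub_of_discounted hLTER h1 fun β hβ hβ1 M => ?_
    have h3 := hI.calcLambda_le (.mono hD (admissible_discounted (C := D) (P := P)
      (good := Set.univ) (w := ⟨0, 0, 1, (1 - β) / β, le_rfl, le_rfl, zero_le_one,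
        div_pos (by linarith) hβ⟩) hβ hβ1 rfl rfl (by simp) (by simp) M))
    simpa using h3

end Pandor

-- Reduction to total controllers on `Fin N`.

namespace FSC

variable {Q Q' S A O : Type*}

/-- The total controller that simulates `C` on the image of `e`, where `g` is a left inverse of
`e`. It stops where `C` has no transition. -/
def simulate (C : FSC Q O A) (e : Q → Q') (g : Q' → Q) : FSC Q' O A where
  q₀ := e C.q₀
  γ := fun i o => match C.γ (g i) o, C.δ (g i) o with
    | some (.act a), some _ => some (.act a)
    | _, _ => some .halt
  δ := fun i o => some ((C.δ (g i) o).elim (e C.q₀) e)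

variable {C : FSC Q O A} {e : Q → Q'} {g : Q' → Q}

theorem simulate_total (i : Q') (o : O) :
    ∃ l q', (C.simulate e g).γ i o = some l ∧ (C.simulate e g).δ i o = some q' := by
  unfold simulate
  dsimp only
  split <;> exact ⟨_, _, rfl, rfl⟩

/-- Only an inequality, because the simulating controller also halts where `C` is stuck. -/
theorem exitProb_le_simulate (hg : Function.LeftInverse g e) (E : Environment S A O) (good : Set S)
    (n : ℕ) (q : Q) (s : S) :
    C.exitProb E good n (q, s) ≤ (C.simulate e g).exitProb E good n (e q, s) := by
  classical
  induction n generalizing q s with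
  | zero =>
    by_cases h : C.γ q (E.Ω s) = some .halt
    · have h' : (C.simulate e g).γ (e q) (E.Ω s) = some .halt := by
        simp only [simulate, hg q, h]
      rw [exitProb_zero_of_halt h, exitProb_zero_of_halt h']
    · simp [exitProb, h]
  | succ n ih =>
    by_cases h : C.Acts E (q, s)
    · obtain ⟨a, q', hγ, hδ⟩ := h
      dsimp only at hγ hδ
      have hγ' : (C.simulate e g).γ (e q) (E.Ω s) = some (.act a) := by
        simp only [simulate, hg q, hγ, hδ]
      have hδ' : (C.simulate e g).δ (e q) (E.Ω s) = some (e q') := by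
        simp only [simulate, hg q, hδ, Option.elim_some]
      rw [exitProb_succ_of_act hγ hδ, exitProb_succ_of_act hγ' hδ']
      exact ENNReal.tsum_le_tsum fun s' => mul_le_mul_right (ih q' s') _
    · rw [exitProb_succ_of_not_acts h]
      exact zero_le

theorem LTER_le_simulate (hg : Function.LeftInverse g e) (P : PlanningProblem S A O) :
    C.LTER P ≤ (C.simulate e g).LTER P := by
  rw [LTER_eq, LTER_eq]
  exact ENNReal.tsum_le_tsum fun n => exitProb_le_simulate hg _ _ n _ _

theorem LGT_le_simulate (hg : Function.LeftInverse g e) (P : PlanningProblem S A O) :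
    C.LGT P ≤ (C.simulate e g).LGT P := by
  rw [LGT_eq, LGT_eq]
  exact ENNReal.tsum_le_tsum fun n => exitProb_le_simulate hg _ _ n _ _

/-- A controller with at most `N` states is simulated by a total one with states `0, …, N - 1` and
initial state `0`. -/
theorem exists_total_of_bounded [Fintype Q] (C : FSC Q O A) {N : ℕ} [NeZero N] (hC : C.Bounded N)
    (P : PlanningProblem S A O) :
    ∃ D : FSC (Fin N) O A, D.q₀ = 0 ∧ (∀ q o, ∃ l q', D.γ q o = some l ∧ D.δ q o = some q') ∧
      C.LTER P ≤ D.LTER P ∧ C.LGT P ≤ D.LGT P := by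
  obtain ⟨f⟩ : Nonempty (Q ↪ Fin N) :=
    Function.Embedding.nonempty_of_card_le (by simpa [Bounded] using hC)
  have : Nonempty Q := ⟨C.q₀⟩
  -- The swap moves the image of the initial state to `0`, where the search starts.
  let e : Q → Fin N := fun q => Equiv.swap (f C.q₀) 0 (f q)
  have he : Function.Injective e := (Equiv.injective _).comp f.injective
  have hg := Function.leftInverse_invFun he
  exact ⟨C.simulate e (Function.invFun e), by simp [simulate, e], simulate_total,
    LTER_le_simulate hg P, LGT_le_simulate hg P⟩

end FSC

-- The start of the search, and the theorem.

namespace Pandor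

section Root

variable {S A O : Type*} {P : PlanningProblem S A O} {N : ℕ} [NeZero N]
  {σ : SearchOrder P.toEnvironment (Fin N)} {LTERstar LGTstar : ℝ}

/-- The pending outcomes at the start of the search. -/
def rootPending (N : ℕ) [NeZero N] (s : S) : ℕ → List ((Fin N × S) × ℝ)
  | 0 => withState 0 [(s, 1)]
  | _ + 1 => []

theorem load_root (w : Weights) (V : Fin N × S → ℝ) :
    load P.toEnvironment (FSC.empty (A := A) 0) [] Alpha.zero (rootPending N P.s₀) w V 0 =
      V (0, P.s₀) := by
  simp [load, rootPending, withState, pendingValue, Alpha.level, Alpha.zero]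

theorem exhaustive_root :
    Exhaustive P (FSC.empty 0) [] Alpha.zero (rootPending N P.s₀) := by
  intro j hj
  obtain rfl := Nat.le_zero.mp hj
  rw [load_root]

theorem continues_root : Continues P (FSC.empty (0 : Fin N)) 0 [(P.s₀, 1)] [] := by
  intro o ho
  obtain rfl := List.mem_singleton.mp ho
  exact ⟨one_pos, rfl⟩

variable [Fintype S]

theorem invariant_root : Invariant P (0, P.s₀) (FSC.empty 0) [] Alpha.zero (rootPending N P.s₀) where
  nonneg := ⟨fun _ => le_rfl, fun _ => le_rfl, fun _ => le_rfl, fun _ _ => le_rfl⟩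
  pos j hj := absurd hj (Nat.not_lt_zero j)
  acts x hx := absurd hx List.not_mem_nil
  pending j e he := by
    cases j with
    | zero =>
      simp only [rootPending, withState, List.map_cons, List.map_nil, List.mem_singleton] at he
      simp [he]
    | succ j => simp [rootPending] at he
  load_le w V _ j hj := by
    obtain rfl := Nat.le_zero.mp hj
    rw [load_root, ceiling]

theorem sound_of_mem_branches {C : FSC (Fin N) O A} (hC : C ∈ branches P N σ LTERstar LGTstar) :
    ENNReal.ofReal LTERstar ≤ C.LTER P ∧ ENNReal.ofReal LGTstar ≤ C.LGT P := by
  classical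
  obtain ⟨r, hr, rfl⟩ := List.mem_map.mp hC
  rw [andStep_cons, List.mem_flatMap] at hr
  obtain ⟨r', hr', hr⟩ := hr
  obtain ⟨h1, h2, h3⟩ := orStepSpec (x₀ := ((0 : Fin N), P.s₀)) _ _ _ _ _ _
    (rootPending N P.s₀) [] rfl invariant_root exhaustive_root one_pos rfl r' hr'
  have hx : ((0 : Fin N), P.s₀) = (r'.1.q₀, P.s₀) := by rw [h1.q₀]; rfl
  rw [hx] at h2
  split_ifs at hr with hs hf
  · obtain rfl := List.mem_singleton.mp hr
    exact hs.le h2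
  · simp at hr
  · exfalso
    -- Exhaustiveness at the root makes the three values add up to one, so passing both pruning
    -- tests would already have been a success.
    have h4 := h3.resolve_right hs 0 le_rfl
    simp only [load, List.length_nil, Function.update_self, pendingValue_nil, Alpha.level,
      Weights.one, Finset.range_zero, Finset.sum_empty, lt_irrefl, if_false] at h4
    simp only [calcLambda, List.length_nil, lamBackward, not_or, not_lt] at hf
    refine hs ⟨?_, ?_⟩
    · simp only [calcLambda, List.length_nil, lamBackward]
      linarith
    · simp only [calcLambda, List.length_nil, lamBackward]
      linarith

/-- The surviving branch along `D` only shows that some branch does not fail. The first one found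
may be unrelated to `D`; its quality comes from soundness. -/
theorem exists_synth_eq_some {D : FSC (Fin N) O A} (hD : D.q₀ = 0)
    (hV : Viable P LTERstar LGTstar (0, P.s₀) D) :
    ∃ C, synth P N σ LTERstar LGTstar = some C := by
  obtain ⟨r, hr, -⟩ := andStepComplete (σ := σ) hV [] (FSC.empty 0) 0 [(P.s₀, 1)] Alpha.zero
    (rootPending N P.s₀) rfl invariant_root exhaustive_root continues_root
    ⟨hD, fun _ _ _ _ h => by simp [FSC.empty] at h⟩
  have hmem : r.1 ∈ branches P N σ LTERstar LGTstar := List.mem_map_of_mem hr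
  exact ⟨_, List.head?_eq_some_head (List.ne_nil_of_mem hmem)⟩

end Root

end Pandor

end

theorem theorem4 {S A O : Type*} [Fintype S] [Fintype A] [Fintype O]
    (P : PlanningProblem S A O) (N : ℕ) [NeZero N]
    (LTERstar LGTstar : ℝ) (hLTER : LTERstar ∈ Set.Ioo (0 : ℝ) 1)
    (hLGT : LGTstar ∈ Set.Ioo (0 : ℝ) 1)
    (σ : Pandor.SearchOrder P.toEnvironment (Fin N)) :
    (∀ C ∈ Pandor.branches P N σ LTERstar LGTstar,
      C.Bounded N ∧ ENNReal.ofReal LTERstar ≤ C.LTER P ∧ ENNReal.ofReal LGTstar ≤ C.LGT P) ∧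
    ((∃ (Q : Type) (_ : Fintype Q) (C : FSC Q O A),
        C.Bounded N ∧ ENNReal.ofReal LTERstar ≤ C.LTER P ∧ ENNReal.ofReal LGTstar ≤ C.LGT P) →
      ∃ C : FSC (Fin N) O A, Pandor.synth P N σ LTERstar LGTstar = some C ∧
        C.Bounded N ∧ ENNReal.ofReal LTERstar ≤ C.LTER P ∧ ENNReal.ofReal LGTstar ≤ C.LGT P) := by
  have hsound : ∀ C ∈ Pandor.branches P N σ LTERstar LGTstar,
      C.Bounded N ∧ ENNReal.ofReal LTERstar ≤ C.LTER P ∧ ENNReal.ofReal LGTstar ≤ C.LGT P :=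
    fun C hC => ⟨(Fintype.card_fin N).le, Pandor.sound_of_mem_branches hC⟩
  refine ⟨hsound, ?_⟩
  rintro ⟨Q, _, C, hC, h1, h2⟩
  obtain ⟨D, hq, htotal, h3, h4⟩ := C.exists_total_of_bounded hC P
  have hV := Pandor.viable_of_le hLTER.1 hLGT.1 htotal (h1.trans h3) (h2.trans h4)
  rw [hq] at hV
  obtain ⟨C', hC'⟩ := Pandor.exists_synth_eq_some (σ := σ) hq hV
  exact ⟨C', hC', hsound C' (List.mem_of_head? hC')⟩
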